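/- All graphs are finite and simple. Let $k\ge 2$. A multiset $\mathscr P$ of paths of a graph $G$ is a \emph{$k$-rainbow separating path system} of $G$ if its elements can be coloured with $k$ colours so that for every two distinct edges $e_1,e_2$ of $G$ there are paths $P_1,P_2\in\mathscr P$ of distinct colours such that $P_1$ contains $e_1$ but not $e_2$, and $P_2$ contains $e_2$ but not $e_1$. Let $c_k(G)$ be the smallest cardinality (counted with multiplicity) of a $k$-rainbow separating path system of $G$. A \emph{spider with $q\ge 3$ legs} is a tree consisting of a centre and $q$ paths (the legs) that start at the centre and are otherwise pairwise vertex-disjoint; the length of a leg is its number of edges. \textbf{Theorem.} Let $S_{n,q}$ be a spider with $n$ vertices and $q\ge 3$ legs, each of length at least $2$. If $q=3$ or at least two legs have length exactly $2$, then \[ c_2(S_{n,q})= \begin{cases} n-1+\lfloor 2q/3\rfloor & \text{if } q=3 \text{ or } q\equiv 1\pmod 3,\\ n-2+\lfloor 2q/3\rfloor & \text{otherwise.} \end{cases} \] If $q>3$ and at most one leg has length exactly $2$, then \[ c_2(S_{n,q})= \begin{cases} n-1+\lfloor 2q/3\rfloor & \text{if } q\equiv 1\pmod 3,\\ n-2+\lfloor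 2q/3\rfloor+\varepsilon & \text{otherwise,} \end{cases} \] where $\varepsilon\in\{0,1\}$ (and may depend on the spider). -/

import Mathlib

namespace RainbowSep

/-- A subgraph `H` of `G` is a path of `G`: it consists of the vertices and edges traversed by a
walk without repeated vertices. -/
def IsPathOf {V : Type*} (G : SimpleGraph V) (H : G.Subgraph) : Prop :=
  ∃ (u v : V) (p : G.Walk u v), p.IsPath ∧ p.toSubgraph = H

/-- A multiset `P` of paths of `G` is a `k`-rainbow separating path system: its elements can be
coloured with `k` colours (`C` is the coloured multiset; repeated copies of a path may receive
different colours) so that any two distinct edges `e₁, e₂` of `G` are separated by two paths of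
distinct colours, one containing `e₁` but not `e₂`, the other containing `e₂` but not `e₁`. -/
def IsRSPS {V : Type*} (G : SimpleGraph V) (k : ℕ) (P : Multiset G.Subgraph) : Prop :=
  (∀ H ∈ P, IsPathOf G H) ∧
  ∃ C : Multiset (G.Subgraph × Fin k), C.map Prod.fst = P ∧
    ∀ e₁ ∈ G.edgeSet, ∀ e₂ ∈ G.edgeSet, e₁ ≠ e₂ →
      ∃ X ∈ C, ∃ Y ∈ C, X.2 ≠ Y.2 ∧
        (e₁ ∈ X.1.edgeSet ∧ e₂ ∉ X.1.edgeSet) ∧ (e₂ ∈ Y.1.edgeSet ∧ e₁ ∉ Y.1.edgeSet)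

/-- The `k`-rainbow separation number `c_k(G)`: the least cardinality (with multiplicity) of a
`k`-rainbow separating path system of `G`. (For finite `G` and `2 ≤ k` such a system exists, for
instance all single-edge paths, each in two colours.) -/
noncomputable def rainbowSepNumber {V : Type*} (G : SimpleGraph V) (k : ℕ) : ℕ :=
  sInf {m : ℕ | ∃ P : Multiset G.Subgraph, IsRSPS G k P ∧ Multiset.card P = m}

/-- The spider with legs of lengths `ℓ 0, …, ℓ (q - 1)`: the vertex `none` is the centre, and
`some ⟨i, j⟩` is the vertex of leg `i` at distance `j + 1` from the centre. -/
def spider {q : ℕ} (ℓ : Fin q → ℕ) : SimpleGraph (Option (Σ i : Fin q, Fin (ℓ i))) :=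
  SimpleGraph.fromRel fun x y =>
    match x, y with
    | none, some b => b.2.val = 0
    | some a, some b => a.1 = b.1 ∧ a.2.val + 1 = b.2.val
    | _, none => False

end RainbowSep

/-!
A path of a spider is given by its two ends, so a separating system is a family of pairs of
vertices, and an edge lies on a path if and only if it separates exactly one of the two ends from
the centre.

Lower bound. Going down a leg, every further edge lies on a path which avoids the previous edge and
hence forces an end; this costs two ends per edge, and it remains to look at the first two edges of
each leg. For each colour consider the sets `F` and `S` of the paths of this colour through the
first and the second edge of the leg. Rainbow separation means that `F ⊈ S` for one colour and
`S ⊈ F` for the other, which bounds `|F| + 3 |S \ F|` from below unless one of `F` and `S` has at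
most one element. Since `F` and `S` determine their edge, each colour has at most one empty class,
and each path is the only element of a class on at most one leg: it is pinned there. Each path has
only two ends, and double counting with weight `2` for a pinned path gives the bound. For three
legs an empty class of a first edge forces a path of its colour to end at the centre, which
improves the bound by one.

Upper bound. There are explicit systems for few legs of length two. The system for three legs covers
each edge in both colours, so it can be added as a disjoint union and no mixed pair of edges needs
attention; and each leg can be lengthened repeatedly, at the price of one path per edge. Giving up
the latter for two legs allows systems with one path fewer when `q > 3` is not `1` modulo `3`.
-/

namespace RainbowSep

section Separates

variable {α β ε ε' κ : Type*} {S : α → Set ε} {C D : Multiset (α × κ)} {e f : ε}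

/-- Separation of `e` from `f` by a coloured family `C`, each `X : α` standing for the set `S X`
of edges. For `S = SimpleGraph.Subgraph.edgeSet` this is the requirement of `IsRSPS`. -/
def Separates (S : α → Set ε) (C : Multiset (α × κ)) (e f : ε) : Prop :=
  ∃ X ∈ C, ∃ Y ∈ C, X.2 ≠ Y.2 ∧ (e ∈ S X.1 ∧ f ∉ S X.1) ∧ (f ∈ S Y.1 ∧ e ∉ S Y.1)

lemma Separates.symm (h : Separates S C e f) : Separates S C f e := by
  obtain ⟨X, hX, Y, hY, hXY, hXe, hYf⟩ := h
  exact ⟨Y, hY, X, hX, hXY.symm, hYf, hXe⟩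

lemma Separates.mono (h : Separates S C e f) (hCD : C ⊆ D) : Separates S D e f := by
  obtain ⟨X, hX, Y, hY, hXY⟩ := h
  exact ⟨X, hCD hX, Y, hCD hY, hXY⟩

lemma Separates.map {T : β → Set ε'} {e' f' : ε'} {F : α × κ → β × κ} (h : Separates S C e f)
    (hF : ∀ X, (F X).2 = X.2) (he : ∀ X ∈ C, (e' ∈ T (F X).1 ↔ e ∈ S X.1))
    (hf : ∀ X ∈ C, (f' ∈ T (F X).1 ↔ f ∈ S X.1)) : Separates T (C.map F) e' f' := by
  obtain ⟨X, hX, Y, hY, hXY, hXe, hYf⟩ := h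
  refine ⟨F X, Multiset.mem_map_of_mem F hX, F Y, Multiset.mem_map_of_mem F hY, ?_, ?_, ?_⟩
  · rwa [hF, hF]
  · rwa [he X hX, hf X hX]
  · rwa [hf Y hY, he Y hY]

end Separates

section Iso

variable {V W : Type*} {G : SimpleGraph V} {G' : SimpleGraph W}

lemma map_mem_edgeSet_map_iso (φ : G ≃g G') (H : G.Subgraph) (e : Sym2 V) :
    Sym2.map φ e ∈ (H.map φ.toHom).edgeSet ↔ e ∈ H.edgeSet := by
  rw [SimpleGraph.Subgraph.edgeSet_map]
  exact (Sym2.map.injective φ.injective).mem_set_image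

lemma IsPathOf.map_iso {H : G.Subgraph} (h : IsPathOf G H) (φ : G ≃g G') :
    IsPathOf G' (H.map φ.toHom) := by
  obtain ⟨u, v, p, hp, rfl⟩ := h
  exact ⟨_, _, p.map φ.toHom, hp.map φ.injective, SimpleGraph.Walk.toSubgraph_map _ _⟩

lemma exists_map_iso_eq (φ : G ≃g G') {e : Sym2 W} (he : e ∈ G'.edgeSet) :
    ∃ f ∈ G.edgeSet, Sym2.map φ f = e := by
  induction e with
  | _ a b => exact ⟨s(φ.symm a, φ.symm b), φ.symm.map_adj_iff.2 he, by simp⟩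

lemma IsRSPS.map_iso {k : ℕ} {P : Multiset G.Subgraph} (h : IsRSPS G k P) (φ : G ≃g G') :
    IsRSPS G' k (P.map (SimpleGraph.Subgraph.map φ.toHom)) := by
  obtain ⟨hP, C, rfl, hsep⟩ := h
  refine ⟨?_, C.map (Prod.map (SimpleGraph.Subgraph.map φ.toHom) id), ?_, ?_⟩
  · intro H hH
    obtain ⟨H, hH', rfl⟩ := Multiset.mem_map.1 hH
    exact (hP H hH').map_iso φ
  · simp only [Multiset.map_map, Function.comp_def, Prod.map_fst]
  · intro e he f hf hne
    obtain ⟨e, he', rfl⟩ := exists_map_iso_eq φ he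
    obtain ⟨f, hf', rfl⟩ := exists_map_iso_eq φ hf
    exact Separates.map (hsep e he' f hf' (ne_of_apply_ne _ hne)) (fun _ => rfl)
      (fun X _ => map_mem_edgeSet_map_iso φ X.1 e) (fun X _ => map_mem_edgeSet_map_iso φ X.1 f)

lemma rainbowSepNumber_congr (φ : G ≃g G') (k : ℕ) :
    rainbowSepNumber G k = rainbowSepNumber G' k := by
  refine congrArg sInf (Set.ext fun m => ⟨?_, ?_⟩)
  · rintro ⟨P, hP, rfl⟩
    exact ⟨_, hP.map_iso φ, Multiset.card_map _ _⟩
  · rintro ⟨P, hP, rfl⟩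
    exact ⟨_, hP.map_iso φ.symm, Multiset.card_map _ _⟩

end Iso

section LegPath

variable {ι κ : Type*}

/-- A path in a spider with legs indexed by `ι`, given by its two ends; the pair `(i, d)` is the
vertex at distance `d` from the centre on leg `i`, so that every `(i, 0)` denotes the centre. As an
edge, `(i, d)` joins the vertices `(i, d)` and `(i, d + 1)`. -/
abbrev LegPath (ι : Type*) := (ι × ℕ) × (ι × ℕ)

/-- The edge `e` separates the vertex `v` from the centre. -/
def Beyond (e v : ι × ℕ) : Prop := e.1 = v.1 ∧ e.2 < v.2

/-- The edges of a path: those which separate exactly one of its ends from the centre. -/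
def LegPath.edges (P : LegPath ι) : Set (ι × ℕ) := {e | Xor (Beyond e P.1) (Beyond e P.2)}

/-- The ends of `P` are vertices of the spider with leg lengths `ℓ`. -/
def LegPath.IsValid (ℓ : ι → ℕ) (P : LegPath ι) : Prop := P.1.2 ≤ ℓ P.1.1 ∧ P.2.2 ≤ ℓ P.2.1

/-- A rainbow separating system of paths of the spider with leg lengths `ℓ`, in coordinates. -/
structure IsSeparating (ℓ : ι → ℕ) (C : Multiset (LegPath ι × κ)) : Prop where
  valid : ∀ X ∈ C, X.1.IsValid ℓ
  sep : ∀ e f : ι × ℕ, e.2 < ℓ e.1 → f.2 < ℓ f.1 → e ≠ f → Separates LegPath.edges C e f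

/-- The spider with leg lengths `ℓ` has a separating system of `M` paths coloured by `κ`. -/
def HasSystem (ℓ : ι → ℕ) (κ : Type*) (M : ℕ) : Prop :=
  ∃ C : Multiset (LegPath ι × κ), IsSeparating ℓ C ∧ Multiset.card C = M

end LegPath

section Cut

variable {V : Type*} {G : SimpleGraph V} {S : Set V} {e : Sym2 V}

lemma even_count_edges_iff [DecidableEq V]
    (h : ∀ a b, G.Adj a b → (s(a, b) = e ↔ Xor (a ∈ S) (b ∈ S))) {u v : V}
    (p : G.Walk u v) : Even (p.edges.count e) ↔ (u ∈ S ↔ v ∈ S) := by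
  induction p with
  | nil => simp
  | @cons u v w hadj p ih =>
    rw [SimpleGraph.Walk.edges_cons, List.count_cons]
    have huv := h u v hadj
    by_cases he : s(u, v) = e
    · simp only [he, true_iff, xor_iff_not_iff'] at huv
      simp only [he, beq_self_eq_true, if_true, Nat.even_add_one, ih]
      tauto
    · simp only [he, false_iff, xor_iff_not_iff'] at huv
      simp [he, ih]
      tauto

lemma mem_edges_iff_xor_of_isTrail (h : ∀ a b, G.Adj a b → (s(a, b) = e ↔ Xor (a ∈ S) (b ∈ S)))
    {u v : V} {p : G.Walk u v} (hp : p.IsTrail) : e ∈ p.edges ↔ Xor (u ∈ S) (v ∈ S) := by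
  classical
  have hparity := even_count_edges_iff h p
  rw [xor_iff_not_iff, ← hparity]
  by_cases he : e ∈ p.edges
  · simp [he, List.count_eq_one_of_mem hp.edges_nodup he]
  · simp [he, List.count_eq_zero_of_not_mem he]

end Cut

section Spider

variable {q : ℕ} {ℓ : Fin q → ℕ}

/-- The vertex of the spider with coordinates `v`; the centre if there is no such vertex. -/
def spiderVertex (ℓ : Fin q → ℕ) : Fin q × ℕ → Option (Σ i : Fin q, Fin (ℓ i))
  | (_, 0) => none
  | (i, d + 1) => if h : d < ℓ i then some ⟨i, d, h⟩ else none

/-- The edge of the spider with coordinates `e`. -/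
def spiderEdge (ℓ : Fin q → ℕ) (e : Fin q × ℕ) : Sym2 (Option (Σ i : Fin q, Fin (ℓ i))) :=
  s(spiderVertex ℓ e, spiderVertex ℓ (e.1, e.2 + 1))

/-- The vertices which the edge `e` separates from the centre. -/
def farSide (ℓ : Fin q → ℕ) (e : Fin q × ℕ) : Set (Option (Σ i : Fin q, Fin (ℓ i))) :=
  {w | ∃ b ∈ w, e.1 = b.1 ∧ e.2 ≤ b.2}

lemma spiderVertex_succ {i : Fin q} {d : ℕ} (hd : d < ℓ i) :
    spiderVertex ℓ (i, d + 1) = some ⟨i, d, hd⟩ := dif_pos hd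

lemma exists_spiderVertex_eq [Nonempty (Fin q)] (w : Option (Σ i : Fin q, Fin (ℓ i))) :
    ∃ v : Fin q × ℕ, v.2 ≤ ℓ v.1 ∧ spiderVertex ℓ v = w := by
  cases w with
  | none => exact ⟨(Classical.arbitrary _, 0), Nat.zero_le _, rfl⟩
  | some b => exact ⟨(b.1, b.2 + 1), b.2.isLt, spiderVertex_succ b.2.isLt⟩

lemma spiderVertex_mem_farSide_iff {v : Fin q × ℕ} (hv : v.2 ≤ ℓ v.1) (e : Fin q × ℕ) :
    spiderVertex ℓ v ∈ farSide ℓ e ↔ Beyond e v := by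
  obtain ⟨i, _ | d⟩ := v
  · simp [spiderVertex, farSide, Beyond]
  · rw [spiderVertex_succ hv, Beyond, Nat.lt_succ_iff]
    exact ⟨fun ⟨_, rfl, h⟩ => h, fun h => ⟨_, rfl, h⟩⟩

lemma spider_adj_spiderVertex {e : Fin q × ℕ} (he : e.2 < ℓ e.1) :
    (spider ℓ).Adj (spiderVertex ℓ e) (spiderVertex ℓ (e.1, e.2 + 1)) := by
  obtain ⟨i, _ | d⟩ := e
  · rw [spiderVertex_succ he]
    simp [spiderVertex, spider]
  · simp [spiderVertex_succ he, spiderVertex_succ (Nat.lt_of_succ_lt he), spider]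

lemma exists_spiderEdge_eq {e : Sym2 (Option (Σ i : Fin q, Fin (ℓ i)))}
    (he : e ∈ (spider ℓ).edgeSet) : ∃ f : Fin q × ℕ, f.2 < ℓ f.1 ∧ spiderEdge ℓ f = e := by
  revert he
  refine Sym2.ind (fun a b => ?_) e
  rw [SimpleGraph.mem_edgeSet, spider, SimpleGraph.fromRel_adj]
  rcases a with _ | ⟨i, d, hd⟩ <;> rcases b with _ | ⟨j, d', hd'⟩ <;> rintro ⟨-, h | h⟩ <;>
    simp only at h
  · subst h
    exact ⟨(j, 0), hd', by rw [spiderEdge, spiderVertex_succ hd']; rfl⟩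
  · subst h
    exact ⟨(i, 0), hd, by rw [spiderEdge, spiderVertex_succ hd, Sym2.eq_swap]; rfl⟩
  · obtain ⟨rfl, rfl⟩ : i = j ∧ d + 1 = d' := h
    exact ⟨(i, d + 1), hd', by rw [spiderEdge, spiderVertex_succ hd, spiderVertex_succ hd']⟩
  · obtain ⟨rfl, rfl⟩ : j = i ∧ d' + 1 = d := h
    exact ⟨(j, d' + 1), hd, by
      rw [spiderEdge, spiderVertex_succ hd, spiderVertex_succ hd', Sym2.eq_swap]⟩

lemma xor_beyond_succ_iff (e f : Fin q × ℕ) :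
    Xor (Beyond e f) (Beyond e (f.1, f.2 + 1)) ↔ f = e := by
  simp only [Beyond, xor_iff_not_iff, Prod.ext_iff]
  grind

lemma spiderEdge_injOn : Set.InjOn (spiderEdge ℓ) {e | e.2 < ℓ e.1} := by
  intro e he f hf h
  have hcross : ∀ {f : Fin q × ℕ}, f.2 < ℓ f.1 → ∀ e, Xor (spiderVertex ℓ f ∈ farSide ℓ e)
      (spiderVertex ℓ (f.1, f.2 + 1) ∈ farSide ℓ e) ↔ f = e := fun hf e => by
    rw [spiderVertex_mem_farSide_iff hf.le, spiderVertex_mem_farSide_iff hf, xor_beyond_succ_iff]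
  rw [← hcross he]
  have hself := (hcross hf f).2 rfl
  rcases Sym2.eq_iff.1 h with ⟨h1, h2⟩ | ⟨h1, h2⟩ <;> rw [h1, h2]
  · exact hself
  · exact hself.symm

lemma eq_spiderEdge_iff {e : Fin q × ℕ} (he : e.2 < ℓ e.1)
    {a b : Option (Σ i : Fin q, Fin (ℓ i))} (hab : (spider ℓ).Adj a b) :
    s(a, b) = spiderEdge ℓ e ↔ Xor (a ∈ farSide ℓ e) (b ∈ farSide ℓ e) := by
  obtain ⟨f, hf, hfab⟩ := exists_spiderEdge_eq ((spider ℓ).mem_edgeSet.2 hab)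
  have hcross := xor_beyond_succ_iff e f
  rw [← spiderVertex_mem_farSide_iff hf.le, ← spiderVertex_mem_farSide_iff hf] at hcross
  rw [← hfab, spiderEdge_injOn.eq_iff hf he, ← hcross]
  rcases Sym2.eq_iff.1 hfab with ⟨rfl, rfl⟩ | ⟨rfl, rfl⟩
  · rfl
  · rw [xor_comm]

lemma spiderEdge_mem_toSubgraph_iff {P : LegPath (Fin q)} (hP : P.IsValid ℓ)
    {p : (spider ℓ).Walk (spiderVertex ℓ P.1) (spiderVertex ℓ P.2)} (hp : p.IsPath)
    {e : Fin q × ℕ} (he : e.2 < ℓ e.1) :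
    spiderEdge ℓ e ∈ p.toSubgraph.edgeSet ↔ e ∈ P.edges := by
  rw [SimpleGraph.Walk.mem_edges_toSubgraph,
    mem_edges_iff_xor_of_isTrail (fun _ _ => eq_spiderEdge_iff he) hp.isTrail,
    spiderVertex_mem_farSide_iff hP.1, spiderVertex_mem_farSide_iff hP.2]
  rfl

lemma reachable_spiderVertex {v : Fin q × ℕ} (hv : v.2 ≤ ℓ v.1) :
    (spider ℓ).Reachable none (spiderVertex ℓ v) := by
  obtain ⟨i, d⟩ := v
  induction d with
  | zero => exact .rfl
  | succ d ih =>
    exact (ih (Nat.le_of_succ_le hv)).trans (spider_adj_spiderVertex (e := (i, d)) hv).reachable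

/-- The subgraph `H` of the spider has the same edges as the path `P`. -/
def Represents (P : LegPath (Fin q)) (H : (spider ℓ).Subgraph) : Prop :=
  ∀ e : Fin q × ℕ, e.2 < ℓ e.1 → (spiderEdge ℓ e ∈ H.edgeSet ↔ e ∈ P.edges)

lemma IsPathOf.exists_represents [Nonempty (Fin q)] {H : (spider ℓ).Subgraph}
    (hH : IsPathOf (spider ℓ) H) : ∃ P : LegPath (Fin q), P.IsValid ℓ ∧ Represents P H := by
  obtain ⟨u, v, p, hp, rfl⟩ := hH
  obtain ⟨u, hu, rfl⟩ := exists_spiderVertex_eq u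
  obtain ⟨v, hv, rfl⟩ := exists_spiderVertex_eq v
  exact ⟨(u, v), ⟨hu, hv⟩, fun _ => spiderEdge_mem_toSubgraph_iff (P := (u, v)) ⟨hu, hv⟩ hp⟩

lemma LegPath.IsValid.exists_represents {P : LegPath (Fin q)} (hP : P.IsValid ℓ) :
    ∃ H : (spider ℓ).Subgraph, IsPathOf (spider ℓ) H ∧ Represents P H := by
  obtain ⟨p, hp⟩ := ((reachable_spiderVertex hP.1).symm.trans
    (reachable_spiderVertex hP.2)).exists_isPath
  exact ⟨p.toSubgraph, ⟨_, _, p, hp, rfl⟩, fun _ => spiderEdge_mem_toSubgraph_iff hP hp⟩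

lemma IsRSPS.hasSystem [Nonempty (Fin q)] {k : ℕ} {P : Multiset (spider ℓ).Subgraph}
    (hP : IsRSPS (spider ℓ) k P) : HasSystem ℓ (Fin k) (Multiset.card P) := by
  obtain ⟨hP, C, rfl, hsep⟩ := hP
  choose! F hvalid hF using fun H hH => (hP H hH).exists_represents
  have hmem : ∀ X ∈ C, X.1 ∈ C.map Prod.fst := fun _ => Multiset.mem_map_of_mem Prod.fst
  refine ⟨C.map (Prod.map F id), ⟨fun X hX => ?_, fun e f he hf hne => ?_⟩, ?_⟩
  · obtain ⟨X, hX', rfl⟩ := Multiset.mem_map.1 hX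
    exact hvalid X.1 (hmem X hX')
  · exact Separates.map (hsep _ (spider_adj_spiderVertex he) _ (spider_adj_spiderVertex hf)
      (spiderEdge_injOn.ne he hf hne)) (fun _ => rfl)
      (fun X hX => (hF X.1 (hmem X hX) e he).symm) (fun X hX => (hF X.1 (hmem X hX) f hf).symm)
  · rw [Multiset.card_map, Multiset.card_map]

lemma HasSystem.exists_isRSPS {k M : ℕ} (h : HasSystem ℓ (Fin k) M) :
    ∃ P : Multiset (spider ℓ).Subgraph, IsRSPS (spider ℓ) k P ∧ Multiset.card P = M := by
  obtain ⟨C, hC, rfl⟩ := h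
  choose! F hpath hF using fun (P : LegPath (Fin q)) (hP : P.IsValid ℓ) => hP.exists_represents
  refine ⟨_, ⟨?_, C.map (Prod.map F id), rfl, ?_⟩, ?_⟩
  · simp only [Multiset.map_map, Multiset.mem_map]
    rintro _ ⟨X, hX, rfl⟩
    exact hpath X.1 (hC.valid X hX)
  · intro e he f hf hne
    obtain ⟨e, he', rfl⟩ := exists_spiderEdge_eq he
    obtain ⟨f, hf', rfl⟩ := exists_spiderEdge_eq hf
    exact Separates.map (hC.sep e f he' hf' (ne_of_apply_ne _ hne)) (fun _ => rfl)
      (fun X hX => hF X.1 (hC.valid X hX) e he') (fun X hX => hF X.1 (hC.valid X hX) f hf')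
  · rw [Multiset.card_map, Multiset.card_map]

lemma rainbowSepNumber_spider [Nonempty (Fin q)] (ℓ : Fin q → ℕ) (k : ℕ) :
    rainbowSepNumber (spider ℓ) k = sInf {M | HasSystem ℓ (Fin k) M} := by
  refine congrArg sInf (Set.ext fun M => ⟨?_, HasSystem.exists_isRSPS⟩)
  rintro ⟨P, hP, rfl⟩
  exact hP.hasSystem

end Spider

section Lengthen

variable {ι κ : Type*} {ℓ ℓ' : ι → ℕ} {C : Multiset (LegPath ι × κ)}

lemma LegPath.IsValid.mono {P : LegPath ι} (hP : P.IsValid ℓ) (hℓ : ℓ ≤ ℓ') : P.IsValid ℓ' :=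
  ⟨hP.1.trans (hℓ _), hP.2.trans (hℓ _)⟩

lemma LegPath.IsValid.lt_of_mem_edges {P : LegPath ι} (hP : P.IsValid ℓ) {e : ι × ℕ}
    (he : e ∈ P.edges) : e.2 < ℓ e.1 := by
  rcases he with ⟨⟨h, hlt⟩, -⟩ | ⟨⟨h, hlt⟩, -⟩
  · exact h ▸ hlt.trans_le hP.1
  · exact h ▸ hlt.trans_le hP.2

lemma LegPath.mem_edges_step_iff {e v : ι × ℕ} :
    e ∈ LegPath.edges (v, (v.1, v.2 + 1)) ↔ e = v := by
  simp only [LegPath.edges, Beyond, Set.mem_ofPred_eq, xor_iff_not_iff, Prod.ext_iff]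
  grind

lemma sum_update_succ [Fintype ι] [DecidableEq ι] (ℓ : ι → ℕ) (i : ι) :
    ∑ j, Function.update ℓ i (ℓ i + 1) j = ∑ j, ℓ j + 1 := by
  have : ∀ j, Function.update ℓ i (ℓ i + 1) j = ℓ j + if j = i then 1 else 0 := fun j => by
    rw [Function.update_apply]
    split_ifs with hj <;> simp [hj]
  simp [this, Finset.sum_add_distrib]

lemma lt_or_eq_of_lt_update [DecidableEq ι] {i : ι} {e : ι × ℕ}
    (he : e.2 < Function.update ℓ i (ℓ i + 1) e.1) :
    e.2 < ℓ e.1 ∨ e = (i, ℓ i) := by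
  obtain ⟨j, d⟩ := e
  by_cases hj : j = i
  · subst hj
    simp only [Function.update_self] at he
    grind
  · rw [Function.update_of_ne hj] at he
    exact .inl he

/-- Every edge lies on two paths of distinct colours. -/
def Bicoloured (ℓ : ι → ℕ) (C : Multiset (LegPath ι × κ)) : Prop :=
  ∀ e : ι × ℕ, e.2 < ℓ e.1 → ∃ X ∈ C, ∃ Y ∈ C, X.2 ≠ Y.2 ∧ e ∈ X.1.edges ∧ e ∈ Y.1.edges

/-- Three paths of `C` through the last edge `(i, n)` of leg `i` which allow this leg to be
lengthened by one edge at the price of one path: `X₀` and `X₂` are prolonged to the new edge, which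
also becomes a path of its own. -/
structure IsExtender (ℓ : ι → ℕ) (C : Multiset (LegPath ι × κ)) (i : ι) (n : ℕ)
    (X₀ X₁ X₂ : LegPath ι × κ) : Prop where
  length_eq : ℓ i = n + 1
  mem₀ : X₀ ∈ C
  mem₁ : X₁ ∈ C
  mem₂ : X₂ ∈ C
  last_mem₀ : (i, n) ∈ X₀.1.edges
  last_mem₂ : (i, n) ∈ X₂.1.edges
  leg_eq : ∀ e ∈ X₀.1.edges, e.1 = i
  colour_eq : X₁.2 = X₀.2
  ssubset₁ : X₀.1.edges ⊂ X₁.1.edges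
  ssubset₂ : X₂.2 = X₀.2 → X₀.1.edges ⊂ X₂.1.edges
  edges_ne : X₂.2 = X₀.2 → X₂.1.edges ≠ X₁.1.edges

/-- Leg `i` can be lengthened by one edge at the price of one path. -/
def Extendable (ℓ : ι → ℕ) (C : Multiset (LegPath ι × κ)) (i : ι) : Prop :=
  ∃ n X₀ X₁ X₂, IsExtender ℓ C i n X₀ X₁ X₂

variable {i : ι} {n : ℕ} {X₀ X₁ X₂ : LegPath ι × κ}

lemma IsExtender.ne₀ (h : IsExtender ℓ C i n X₀ X₁ X₂) : X₁ ≠ X₀ := by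
  rintro rfl
  exact h.ssubset₁.ne rfl

lemma IsExtender.ne₂ (h : IsExtender ℓ C i n X₀ X₁ X₂) : X₁ ≠ X₂ := by
  rintro rfl
  exact h.edges_ne h.colour_eq rfl

variable [DecidableEq ι] [DecidableEq κ]

/-- The path `P` with its ends at the vertex `v` moved one step away from the centre. -/
def LegPath.stretch (v : ι × ℕ) (P : LegPath ι) : LegPath ι :=
  (if P.1 = v then (v.1, v.2 + 1) else P.1, if P.2 = v then (v.1, v.2 + 1) else P.2)

/-- Stretches `X₀` and `X₂` at the vertex `v` and fixes all other paths. -/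
def stretchPair (v : ι × ℕ) (X₀ X₂ X : LegPath ι × κ) : LegPath ι × κ :=
  if X = X₀ ∨ X = X₂ then (X.1.stretch v, X.2) else X

/-- The system `C` with `X₀` and `X₂` stretched at the leaf `v` and with the new edge beyond `v` as
a path of colour `γ`. -/
def lengthen (v : ι × ℕ) (X₀ X₂ : LegPath ι × κ) (γ : κ) (C : Multiset (LegPath ι × κ)) :
    Multiset (LegPath ι × κ) :=
  ((v, (v.1, v.2 + 1)), γ) ::ₘ C.map (stretchPair v X₀ X₂)

lemma LegPath.IsValid.stretch {P : LegPath ι} (hP : P.IsValid ℓ) (i : ι) :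
    (P.stretch (i, ℓ i)).IsValid (Function.update ℓ i (ℓ i + 1)) := by
  have hle : ℓ ≤ Function.update ℓ i (ℓ i + 1) := by simp
  have hend : ∀ v : ι × ℕ, v.2 ≤ ℓ v.1 → ∀ w, w = (if v = (i, ℓ i) then (i, ℓ i + 1) else v) →
      w.2 ≤ Function.update ℓ i (ℓ i + 1) w.1 := by
    rintro v hv w rfl
    split_ifs
    · simp
    · exact hv.trans (hle v.1)
  exact ⟨hend P.1 hP.1 _ rfl, hend P.2 hP.2 _ rfl⟩

lemma LegPath.IsValid.mem_edges_stretch_iff {P : LegPath ι} (hP : P.IsValid ℓ)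
    (hn : ℓ i = n + 1) (hlast : (i, n) ∈ P.edges) (e : ι × ℕ) :
    e ∈ (P.stretch (i, ℓ i)).edges ↔ e = (i, ℓ i) ∨ e ∈ P.edges := by
  obtain ⟨⟨j, a⟩, ⟨k, b⟩⟩ := P
  obtain ⟨f, c⟩ := e
  simp only [LegPath.IsValid, LegPath.stretch, LegPath.edges, Beyond, Set.mem_ofPred_eq,
    xor_iff_not_iff, Prod.ext_iff] at hP hlast ⊢
  grind

lemma stretchPair_mem_lengthen (v : ι × ℕ) {γ : κ} {X : LegPath ι × κ} (hX : X ∈ C) :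
    stretchPair v X₀ X₂ X ∈ lengthen v X₀ X₂ γ C :=
  Multiset.mem_cons_of_mem (Multiset.mem_map_of_mem _ hX)

lemma stretchPair_colour (v : ι × ℕ) (X : LegPath ι × κ) : (stretchPair v X₀ X₂ X).2 = X.2 := by
  unfold stretchPair
  split_ifs <;> rfl

namespace IsExtender

variable {γ : κ}

lemma mem_edges_stretchPair_iff (h : IsExtender ℓ C i n X₀ X₁ X₂) (hC : IsSeparating ℓ C)
    {X : LegPath ι × κ} (hX : X ∈ C) (e : ι × ℕ) :
    e ∈ (stretchPair (i, ℓ i) X₀ X₂ X).1.edges ↔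
      (e = (i, ℓ i) ∧ (X = X₀ ∨ X = X₂)) ∨ e ∈ X.1.edges := by
  unfold stretchPair
  split_ifs with hX'
  · have hlast : (i, n) ∈ X.1.edges := by
      rcases hX' with rfl | rfl
      exacts [h.last_mem₀, h.last_mem₂]
    rw [(hC.valid X hX).mem_edges_stretch_iff h.length_eq hlast]
    simp only [hX', and_true]
  · simp only [hX', and_false, false_or]

lemma isValid_lengthen (hC : IsSeparating ℓ C) {X : LegPath ι × κ}
    (hX : X ∈ lengthen (i, ℓ i) X₀ X₂ γ C) :
    X.1.IsValid (Function.update ℓ i (ℓ i + 1)) := by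
  rcases Multiset.mem_cons.1 hX with rfl | hX
  · simp [LegPath.IsValid]
  · obtain ⟨X, hX', rfl⟩ := Multiset.mem_map.1 hX
    unfold stretchPair
    split_ifs
    · exact (hC.valid X hX').stretch i
    · exact (hC.valid X hX').mono (by simp)

lemma separates_lengthen_new (h : IsExtender ℓ C i n X₀ X₁ X₂) (hC : IsSeparating ℓ C)
    (hγ : γ ≠ X₀.2) {g : ι × ℕ} (hg : g.2 < ℓ g.1) :
    Separates LegPath.edges (lengthen (i, ℓ i) X₀ X₂ γ C) (i, ℓ i) g := by
  have hleaf : ∀ X ∈ C, (i, ℓ i) ∉ X.1.edges := fun X hX he =>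
    Nat.lt_irrefl _ ((hC.valid X hX).lt_of_mem_edges he)
  have hne : g ≠ (i, ℓ i) := by rintro rfl; exact Nat.lt_irrefl _ hg
  have hfix : ∀ Y ∈ C, Y ≠ X₀ → Y ≠ X₂ → Y ∈ lengthen (i, ℓ i) X₀ X₂ γ C :=
    fun Y hY h₀ h₂ => Multiset.mem_cons_of_mem
      (Multiset.mem_map.2 ⟨Y, hY, if_neg (not_or.2 ⟨h₀, h₂⟩)⟩)
  have hnew : ∀ Y ∈ C, Y ≠ X₀ → Y ≠ X₂ → γ ≠ Y.2 → g ∈ Y.1.edges →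
      Separates LegPath.edges (lengthen (i, ℓ i) X₀ X₂ γ C) (i, ℓ i) g :=
    fun Y hY h₀ h₂ hcol hgY => ⟨_, Multiset.mem_cons_self _ _, Y, hfix Y hY h₀ h₂, hcol,
      ⟨LegPath.mem_edges_step_iff.2 rfl, mt LegPath.mem_edges_step_iff.1 hne⟩, hgY, hleaf Y hY⟩
  by_cases hg₀ : g ∈ X₀.1.edges
  · exact hnew X₁ h.mem₁ h.ne₀ h.ne₂ (h.colour_eq.symm ▸ hγ) (h.ssubset₁.subset hg₀)
  · obtain ⟨Y, hY, -, -, -, ⟨hgY, hlast⟩, -⟩ := hC.sep g (i, n) hg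
      (by simp only [h.length_eq, Nat.lt_succ_self]) (by rintro rfl; exact hg₀ h.last_mem₀)
    have hY₀ : Y ≠ X₀ := by rintro rfl; exact hlast h.last_mem₀
    have hY₂ : Y ≠ X₂ := by rintro rfl; exact hlast h.last_mem₂
    by_cases hcol : γ = Y.2
    · refine ⟨_, stretchPair_mem_lengthen _ h.mem₀, Y, hfix Y hY hY₀ hY₂, ?_, ?_, hgY, hleaf Y hY⟩
      · rwa [stretchPair_colour, ← hcol, ne_comm]
      · simp only [h.mem_edges_stretchPair_iff hC h.mem₀, true_or, and_self, hne, hg₀, false_and,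
          or_self, not_false_eq_true]
    · exact hnew Y hY hY₀ hY₂ hcol hgY

lemma mem_edges_stretchPair_of_ne (h : IsExtender ℓ C i n X₀ X₁ X₂) (hC : IsSeparating ℓ C)
    {X : LegPath ι × κ} (hX : X ∈ C) {e : ι × ℕ} (he : e ≠ (i, ℓ i)) :
    e ∈ (stretchPair (i, ℓ i) X₀ X₂ X).1.edges ↔ e ∈ X.1.edges := by
  simp only [h.mem_edges_stretchPair_iff hC hX, he, false_and, false_or]

lemma isSeparating_lengthen (h : IsExtender ℓ C i n X₀ X₁ X₂) (hC : IsSeparating ℓ C)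
    (hγ : γ ≠ X₀.2) :
    IsSeparating (Function.update ℓ i (ℓ i + 1)) (lengthen (i, ℓ i) X₀ X₂ γ C) := by
  refine ⟨fun X => isValid_lengthen hC, fun e f he hf hne => ?_⟩
  rcases lt_or_eq_of_lt_update he with he | rfl <;> rcases lt_or_eq_of_lt_update hf with hf | rfl
  · have hold : ∀ g : ι × ℕ, g.2 < ℓ g.1 → ∀ X ∈ C,
        (g ∈ (stretchPair (i, ℓ i) X₀ X₂ X).1.edges ↔ g ∈ X.1.edges) := fun g hg X hX =>
      h.mem_edges_stretchPair_of_ne hC hX (by rintro rfl; exact Nat.lt_irrefl _ hg)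
    exact ((hC.sep e f he hf hne).map (stretchPair_colour _) (hold e he) (hold f hf)).mono
      (Multiset.subset_cons _ _)
  · exact (h.separates_lengthen_new hC hγ he).symm
  · exact h.separates_lengthen_new hC hγ hf
  · exact absurd rfl hne

lemma bicoloured_lengthen (h : IsExtender ℓ C i n X₀ X₁ X₂) (hC : IsSeparating ℓ C)
    (hγ : γ ≠ X₀.2) (hbi : Bicoloured ℓ C) :
    Bicoloured (Function.update ℓ i (ℓ i + 1)) (lengthen (i, ℓ i) X₀ X₂ γ C) := by
  intro e he
  rcases lt_or_eq_of_lt_update he with he | rfl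
  · obtain ⟨X, hX, Y, hY, hXY, heX, heY⟩ := hbi e he
    refine ⟨_, stretchPair_mem_lengthen _ hX, _, stretchPair_mem_lengthen _ hY, ?_,
      (h.mem_edges_stretchPair_iff hC hX e).2 (.inr heX),
      (h.mem_edges_stretchPair_iff hC hY e).2 (.inr heY)⟩
    rwa [stretchPair_colour, stretchPair_colour]
  · refine ⟨_, Multiset.mem_cons_self _ _, _, stretchPair_mem_lengthen _ h.mem₀, ?_,
      LegPath.mem_edges_step_iff.2 rfl,
      (h.mem_edges_stretchPair_iff hC h.mem₀ _).2 (.inl ⟨rfl, .inl rfl⟩)⟩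
    rwa [stretchPair_colour]

lemma mem_edges_stretchPair_iff_of_stretched (h : IsExtender ℓ C i n X₀ X₁ X₂)
    (hC : IsSeparating ℓ C) {X : LegPath ι × κ} (hX : X ∈ C) (hX' : X = X₀ ∨ X = X₂) (e : ι × ℕ) :
    e ∈ (stretchPair (i, ℓ i) X₀ X₂ X).1.edges ↔ e = (i, ℓ i) ∨ e ∈ X.1.edges := by
  rw [h.mem_edges_stretchPair_iff hC hX, and_iff_left hX']

lemma extendable_lengthen_of_colour_eq (h : IsExtender ℓ C i n X₀ X₁ X₂) (hC : IsSeparating ℓ C)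
    (hγ : γ ≠ X₀.2) (hcol : X₂.2 = X₀.2) :
    Extendable (Function.update ℓ i (ℓ i + 1)) (lengthen (i, ℓ i) X₀ X₂ γ C) i := by
  have hF₀ := h.mem_edges_stretchPair_iff_of_stretched hC h.mem₀ (.inl rfl)
  have hF₂ := h.mem_edges_stretchPair_iff_of_stretched hC h.mem₂ (.inr rfl)
  have hnew : γ ≠ (stretchPair (i, ℓ i) X₀ X₂ X₀).2 := by rwa [stretchPair_colour]
  obtain ⟨hsub, x, hx₂, hx₀⟩ := Set.ssubset_iff_exists.1 (h.ssubset₂ hcol)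
  have hx : x ≠ (i, ℓ i) := by
    rintro rfl
    exact Nat.lt_irrefl _ ((hC.valid X₂ h.mem₂).lt_of_mem_edges hx₂)
  refine ⟨ℓ i, _, _, _, by simp, stretchPair_mem_lengthen _ h.mem₀,
    stretchPair_mem_lengthen _ h.mem₂, Multiset.mem_cons_self _ _, (hF₀ _).2 (.inl rfl),
    LegPath.mem_edges_step_iff.2 rfl, fun e he => ?_,
    by rw [stretchPair_colour, stretchPair_colour, hcol],
    Set.ssubset_iff_exists.2 ⟨fun e he => ?_, x, (hF₂ x).2 (.inr hx₂), ?_⟩,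
    fun heq => absurd heq hnew, fun heq => absurd heq hnew⟩
  · rcases (hF₀ e).1 he with rfl | he
    exacts [rfl, h.leg_eq e he]
  · exact (hF₂ e).2 (((hF₀ e).1 he).imp_right fun he => hsub he)
  · rw [hF₀]
    exact not_or.2 ⟨hx, hx₀⟩

lemma extendable_lengthen_of_colour_ne (h : IsExtender ℓ C i n X₀ X₁ X₂) (hC : IsSeparating ℓ C)
    (hcol : X₂.2 ≠ X₀.2) :
    Extendable (Function.update ℓ i (ℓ i + 1)) (lengthen (i, ℓ i) X₀ X₂ X₂.2 C) i := by
  have hF₀ := h.mem_edges_stretchPair_iff_of_stretched hC h.mem₀ (.inl rfl)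
  have hF₂ := h.mem_edges_stretchPair_iff_of_stretched hC h.mem₂ (.inr rfl)
  have hnew : (stretchPair (i, ℓ i) X₀ X₂ X₀).2 ≠ X₂.2 := by
    rw [stretchPair_colour]
    exact hcol.symm
  refine ⟨ℓ i, _, _, _, by simp, Multiset.mem_cons_self _ _, stretchPair_mem_lengthen _ h.mem₂,
    stretchPair_mem_lengthen _ h.mem₀, LegPath.mem_edges_step_iff.2 rfl, (hF₀ _).2 (.inl rfl),
    fun e he => by rw [LegPath.mem_edges_step_iff.1 he], stretchPair_colour _ _,
    Set.ssubset_iff_exists.2 ⟨fun e he => (hF₂ e).2 (.inl (LegPath.mem_edges_step_iff.1 he)),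
      (i, n), (hF₂ _).2 (.inr h.last_mem₂), ?_⟩,
    fun heq => absurd heq hnew, fun heq => absurd heq hnew⟩
  rw [LegPath.mem_edges_step_iff, h.length_eq]
  simp

lemma extendable_lengthen_of_ne (h : IsExtender ℓ C i n X₀ X₁ X₂) (hC : IsSeparating ℓ C)
    {j : ι} (hj : j ≠ i) (hext : Extendable ℓ C j) :
    Extendable (Function.update ℓ i (ℓ i + 1)) (lengthen (i, ℓ i) X₀ X₂ γ C) j := by
  obtain ⟨m, Y₀, Y₁, Y₂, hY⟩ := hext
  set F := stretchPair (i, ℓ i) X₀ X₂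
  have hmem : ∀ X ∈ C, F X ∈ lengthen (i, ℓ i) X₀ X₂ γ C := fun X hX =>
    stretchPair_mem_lengthen _ hX
  have hcolour : ∀ X, (F X).2 = X.2 := stretchPair_colour _
  have hdiff : ∀ X ∈ C, (F X).1.edges \ {(i, ℓ i)} = X.1.edges := fun X hX => by
    ext e
    have := (hC.valid X hX).lt_of_mem_edges (e := e)
    simp only [Set.mem_sdiff, Set.mem_singleton_iff, F, h.mem_edges_stretchPair_iff hC hX]
    grind
  have hsub : ∀ X ∈ C, X.1.edges ⊆ (F X).1.edges := fun X hX =>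
    (hdiff X hX).ge.trans Set.sdiff_subset
  have hY₀ : F Y₀ = Y₀ := if_neg fun hY₀ => hj.symm <| hY.leg_eq (i, n) <| by
    rcases hY₀ with rfl | rfl
    exacts [h.last_mem₀, h.last_mem₂]
  have hssub : ∀ X ∈ C, Y₀.1.edges ⊂ X.1.edges → (F Y₀).1.edges ⊂ (F X).1.edges := fun X hX hlt =>
    hY₀.symm ▸ hlt.trans_subset (hsub X hX)
  refine ⟨m, F Y₀, F Y₁, F Y₂, ?_, hmem Y₀ hY.mem₀, hmem Y₁ hY.mem₁, hmem Y₂ hY.mem₂,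
    hsub Y₀ hY.mem₀ hY.last_mem₀, hsub Y₂ hY.mem₂ hY.last_mem₂, hY₀.symm ▸ hY.leg_eq, ?_,
    hssub Y₁ hY.mem₁ hY.ssubset₁, ?_, ?_⟩
  · rw [Function.update_of_ne hj, hY.length_eq]
  · rw [hcolour, hcolour, hY.colour_eq]
  · rw [hcolour, hcolour]
    exact fun hcol => hssub Y₂ hY.mem₂ (hY.ssubset₂ hcol)
  · rw [hcolour, hcolour]
    intro hcol heq
    exact hY.edges_ne hcol (by rw [← hdiff Y₁ hY.mem₁, ← hdiff Y₂ hY.mem₂, heq])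

end IsExtender

end Lengthen

section ExistsLengthen

variable {ι κ : Type*} [Nontrivial κ] {ℓ ℓ' : ι → ℕ} {C : Multiset (LegPath ι × κ)}

lemma IsSeparating.exists_update_succ [DecidableEq ι] (hC : IsSeparating ℓ C) {i : ι}
    (hi : Extendable ℓ C i) :
    ∃ C' : Multiset (LegPath ι × κ), IsSeparating (Function.update ℓ i (ℓ i + 1)) C' ∧
      Multiset.card C' = Multiset.card C + 1 ∧
      (∀ j, Extendable ℓ C j → Extendable (Function.update ℓ i (ℓ i + 1)) C' j) ∧
      (Bicoloured ℓ C → Bicoloured (Function.update ℓ i (ℓ i + 1)) C') := by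
  classical
  obtain ⟨n, X₀, X₁, X₂, h⟩ := id hi
  obtain ⟨γ, hγ, hself⟩ : ∃ γ, γ ≠ X₀.2 ∧
      Extendable (Function.update ℓ i (ℓ i + 1)) (lengthen (i, ℓ i) X₀ X₂ γ C) i := by
    by_cases hcol : X₂.2 = X₀.2
    · obtain ⟨γ, hγ⟩ := exists_ne X₀.2
      exact ⟨γ, hγ, h.extendable_lengthen_of_colour_eq hC hγ hcol⟩
    · exact ⟨X₂.2, hcol, h.extendable_lengthen_of_colour_ne hC hcol⟩
  refine ⟨lengthen (i, ℓ i) X₀ X₂ γ C, h.isSeparating_lengthen hC hγ, by simp [lengthen],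
    fun j hj => ?_, h.bicoloured_lengthen hC hγ⟩
  by_cases hji : j = i
  · exact hji ▸ hself
  · exact h.extendable_lengthen_of_ne hC hji hj

lemma IsSeparating.exists_lengthen [Fintype ι] (hC : IsSeparating ℓ C) (hℓ : ℓ ≤ ℓ')
    (hext : ∀ i, ℓ i ≠ ℓ' i → Extendable ℓ C i) :
    ∃ C' : Multiset (LegPath ι × κ), IsSeparating ℓ' C' ∧
      Multiset.card C' + ∑ i, ℓ i = Multiset.card C + ∑ i, ℓ' i ∧
      (Bicoloured ℓ C → Bicoloured ℓ' C') := by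
  classical
  obtain ⟨d, hd⟩ := Nat.exists_eq_add_of_le (Finset.sum_le_sum fun i (_ : i ∈ Finset.univ) => hℓ i)
  induction d generalizing ℓ C with
  | zero =>
    obtain rfl : ℓ = ℓ' := funext fun i =>
      (Finset.sum_eq_sum_iff_of_le fun i _ => hℓ i).1 hd.symm i (Finset.mem_univ i)
    exact ⟨C, hC, rfl, id⟩
  | succ d ih =>
    obtain ⟨i, hi⟩ : ∃ i, ℓ i ≠ ℓ' i := by
      by_contra! heq
      simp [heq] at hd
    obtain ⟨C₁, hC₁, hcard₁, hext₁, hbi₁⟩ := hC.exists_update_succ (hext i hi)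
    have hsum := sum_update_succ ℓ i
    have hle : Function.update ℓ i (ℓ i + 1) ≤ ℓ' :=
      update_le_iff.2 ⟨lt_of_le_of_ne (hℓ i) hi, fun j _ => hℓ j⟩
    have hext' : ∀ j, Function.update ℓ i (ℓ i + 1) j ≠ ℓ' j →
        Extendable (Function.update ℓ i (ℓ i + 1)) C₁ j := fun j hj => hext₁ j <| hext j <| by
      rintro heq
      rw [Function.update_of_ne (by rintro rfl; exact hi heq)] at hj
      exact hj heq
    obtain ⟨C', hC', hcard', hbi'⟩ := ih hC₁ hle hext' (by omega)
    exact ⟨C', hC', by omega, fun h => hbi' (hbi₁ h)⟩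

end ExistsLengthen

section BaseSystems

variable {ι κ : Type*} {C : Multiset (LegPath ι × κ)}

instance {α : Type*} (C : Multiset α) (p : α → Prop) [DecidablePred p] :
    Decidable (∃ X ∈ C, p X) :=
  Multiset.decidableExistsMultiset

instance [DecidableEq ι] (e v : ι × ℕ) : Decidable (Beyond e v) :=
  inferInstanceAs (Decidable (_ ∧ _))

instance [DecidableEq ι] (P : LegPath ι) (e : ι × ℕ) : Decidable (e ∈ P.edges) :=
  inferInstanceAs (Decidable (Xor _ _))

instance (ℓ : ι → ℕ) (P : LegPath ι) : Decidable (P.IsValid ℓ) :=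
  inferInstanceAs (Decidable (_ ∧ _))

instance {α ε : Type*} [DecidableEq κ] (S : α → Set ε) [∀ X e, Decidable (e ∈ S X)]
    (C : Multiset (α × κ)) (e f : ε) : Decidable (Separates S C e f) :=
  inferInstanceAs (Decidable (∃ X ∈ C, ∃ Y ∈ C, _))

lemma isSeparating_const {n : ℕ} (hvalid : ∀ X ∈ C, X.1.IsValid fun _ => n)
    (hsep : ∀ e f : ι × Fin n, e ≠ f → Separates LegPath.edges C (e.1, e.2) (f.1, f.2)) :
    IsSeparating (fun _ => n) C :=
  ⟨hvalid, fun e f he hf hne => hsep (e.1, ⟨e.2, he⟩) (f.1, ⟨f.2, hf⟩) fun h =>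
    hne (congrArg (Prod.map id Fin.val) h)⟩

lemma extendable_two {i : ι} (h : ∃ X₀ ∈ C, X₀.1 = ((i, 1), (i, 2)) ∧ ∃ X₁ ∈ C, ∃ X₂ ∈ C,
      X₁.2 = X₀.2 ∧ (i, 0) ∈ X₁.1.edges ∧ (i, 1) ∈ X₁.1.edges ∧ (i, 1) ∈ X₂.1.edges ∧
      (X₂.2 = X₀.2 → ∃ f : ι × Fin 2, (f.1, f.2.val) ∈ X₂.1.edges ∧ (f.1, f.2.val) ∉ X₁.1.edges)) :
    Extendable (fun _ => 2) C i := by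
  obtain ⟨X₀, hX₀, hedge, X₁, hX₁, X₂, hX₂, hcol, h0, h1, h2, hdiff⟩ := h
  have hX₀edges : X₀.1.edges = {(i, 1)} := Set.ext fun e => hedge ▸ LegPath.mem_edges_step_iff
  refine ⟨1, X₀, X₁, X₂, rfl, hX₀, hX₁, hX₂, ?_, h2, ?_, hcol, ?_, fun hcol' => ?_,
    fun hcol' heq => ?_⟩
  · simp [hX₀edges]
  · simp +contextual [hX₀edges]
  · rw [hX₀edges, Set.ssubset_iff_exists]
    exact ⟨by simpa using h1, (i, 0), h0, by simp⟩
  · obtain ⟨f, hf₂, hf₁⟩ := hdiff hcol'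
    rw [hX₀edges, Set.ssubset_iff_exists]
    exact ⟨by simpa using h2, _, hf₂, by rintro hf; exact hf₁ (hf ▸ h1)⟩
  · obtain ⟨f, hf₂, hf₁⟩ := hdiff hcol'
    exact hf₁ (heq ▸ hf₂)

/-- A system for three legs of length two. -/
def threeLegs : Multiset (LegPath (Fin 3) × Fin 2) :=
  {(((0, 2), (1, 1)), 0), (((1, 2), (2, 1)), 0), (((2, 2), (0, 1)), 0), (((1, 2), (0, 2)), 1),
    (((2, 2), (0, 1)), 1), (((0, 1), (0, 2)), 1), (((1, 1), (1, 2)), 1), (((2, 1), (2, 2)), 1)}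

lemma isSeparating_threeLegs : IsSeparating (fun _ => 2) threeLegs :=
  isSeparating_const (by decide +kernel) (by decide +kernel)

lemma extendable_threeLegs : ∀ i, Extendable (fun _ => 2) threeLegs i :=
  fun i => extendable_two (by revert i; decide +kernel)

lemma bicoloured_threeLegs : Bicoloured (fun _ => 2) threeLegs := by
  have h : ∀ e : Fin 3 × Fin 2, ∃ X ∈ threeLegs, ∃ Y ∈ threeLegs,
      X.2 ≠ Y.2 ∧ (e.1, e.2.val) ∈ X.1.edges ∧ (e.1, e.2.val) ∈ Y.1.edges := by decide +kernel
  exact fun e he => h (e.1, ⟨e.2, he⟩)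

/-- A system for four legs of length two. -/
def fourLegs : Multiset (LegPath (Fin 4) × Fin 2) :=
  {(((2, 2), (0, 2)), 1), (((1, 1), (2, 1)), 1), (((3, 2), (0, 2)), 1), (((3, 2), (1, 2)), 0),
    (((0, 1), (3, 1)), 0), (((2, 2), (1, 2)), 0), (((0, 1), (0, 2)), 1), (((1, 1), (1, 2)), 0),
    (((2, 1), (2, 2)), 0), (((3, 1), (3, 2)), 1)}

lemma isSeparating_fourLegs : IsSeparating (fun _ => 2) fourLegs :=
  isSeparating_const (by decide +kernel) (by decide +kernel)

lemma extendable_fourLegs : ∀ i, Extendable (fun _ => 2) fourLegs i :=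
  fun i => extendable_two (by revert i; decide +kernel)

/-- A system for five legs of length two. -/
def fiveLegs : Multiset (LegPath (Fin 5) × Fin 2) :=
  {(((2, 2), (0, 2)), 1), (((1, 1), (2, 1)), 1), (((3, 2), (4, 1)), 1), (((4, 2), (0, 2)), 1),
    (((3, 2), (1, 2)), 0), (((0, 1), (3, 1)), 0), (((2, 2), (1, 2)), 0), (((4, 2), (0, 0)), 0),
    (((0, 1), (0, 2)), 1), (((1, 1), (1, 2)), 0), (((2, 1), (2, 2)), 0), (((3, 1), (3, 2)), 1),
    (((4, 1), (4, 2)), 0)}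

lemma isSeparating_fiveLegs : IsSeparating (fun _ => 2) fiveLegs :=
  isSeparating_const (by decide +kernel) (by decide +kernel)

lemma extendable_fiveLegs : ∀ i, Extendable (fun _ => 2) fiveLegs i :=
  fun i => extendable_two (by revert i; decide +kernel)

/-- A smaller system for five legs of length two, in which legs `0` and `1` cannot be lengthened. -/
def fiveLegsShort : Multiset (LegPath (Fin 5) × Fin 2) :=
  {(((1, 2), (2, 1)), 0), (((2, 2), (3, 1)), 0), (((3, 2), (4, 1)), 0), (((4, 2), (1, 1)), 0),
    (((2, 2), (0, 2)), 1), (((3, 2), (0, 2)), 1), (((4, 2), (0, 1)), 1), (((0, 1), (0, 2)), 0),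
    (((1, 1), (1, 2)), 1), (((2, 1), (2, 2)), 1), (((3, 1), (3, 2)), 1), (((4, 1), (4, 2)), 1)}

lemma isSeparating_fiveLegsShort : IsSeparating (fun _ => 2) fiveLegsShort :=
  isSeparating_const (by decide +kernel) (by decide +kernel)

lemma extendable_fiveLegsShort : ∀ i, i ≠ 0 → i ≠ 1 → Extendable (fun _ => 2) fiveLegsShort i := by
  refine fun i hi₀ hi₁ => extendable_two ?_
  revert i
  decide +kernel

/-- A smaller system for six legs of length two, in which legs `0` and `1` cannot be lengthened. -/
def sixLegsShort : Multiset (LegPath (Fin 6) × Fin 2) :=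
  {(((1, 2), (2, 1)), 0), (((2, 2), (3, 1)), 0), (((3, 2), (4, 1)), 0), (((4, 2), (5, 1)), 0),
    (((5, 2), (1, 1)), 0), (((2, 2), (0, 2)), 1), (((3, 2), (0, 2)), 1), (((4, 2), (0, 1)), 1),
    (((5, 2), (0, 0)), 1), (((0, 1), (0, 2)), 0), (((1, 1), (1, 2)), 1), (((2, 1), (2, 2)), 1),
    (((3, 1), (3, 2)), 1), (((4, 1), (4, 2)), 1), (((5, 1), (5, 2)), 1)}

lemma isSeparating_sixLegsShort : IsSeparating (fun _ => 2) sixLegsShort :=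
  isSeparating_const (by decide +kernel) (by decide +kernel)

lemma extendable_sixLegsShort : ∀ i, i ≠ 0 → i ≠ 1 → Extendable (fun _ => 2) sixLegsShort i := by
  refine fun i hi₀ hi₁ => extendable_two ?_
  revert i
  decide +kernel

end BaseSystems

section Relabel

variable {ι ι' κ : Type*}

/-- The image of a path under a relabelling of the legs. -/
def LegPath.map (f : ι → ι') (P : LegPath ι) : LegPath ι' := (Prod.map f id P.1, Prod.map f id P.2)

lemma LegPath.mem_edges_map_iff {f : ι → ι'} (hf : Function.Injective f) (P : LegPath ι)
    (e : ι × ℕ) : Prod.map f id e ∈ (P.map f).edges ↔ e ∈ P.edges := by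
  simp only [LegPath.edges, LegPath.map, Beyond, Set.mem_ofPred_eq, Prod.map_fst, Prod.map_snd,
    hf.eq_iff, id_eq]

lemma LegPath.notMem_edges_map {f : ι → ι'} (P : LegPath ι) {e : ι' × ℕ}
    (he : e.1 ∉ Set.range f) : e ∉ (P.map f).edges := by
  rintro (⟨⟨h, -⟩, -⟩ | ⟨⟨h, -⟩, -⟩) <;> exact he ⟨_, h.symm⟩

lemma Separates.map_leg {f : ι → ι'} (hf : Function.Injective f) {C : Multiset (LegPath ι × κ)}
    {e e' : ι × ℕ} (h : Separates LegPath.edges C e e') :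
    Separates LegPath.edges (C.map (Prod.map (LegPath.map f) id)) (Prod.map f id e)
      (Prod.map f id e') :=
  Separates.map h (fun _ => rfl) (fun X _ => LegPath.mem_edges_map_iff hf X.1 e)
    (fun X _ => LegPath.mem_edges_map_iff hf X.1 e')

lemma IsSeparating.exists_mem_edges {ℓ : ι → ℕ} {C : Multiset (LegPath ι × κ)}
    (hC : IsSeparating ℓ C) (hℓ : ∀ i, 2 ≤ ℓ i) {e : ι × ℕ} (he : e.2 < ℓ e.1) :
    ∃ X ∈ C, e ∈ X.1.edges := by
  obtain ⟨i, d⟩ := e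
  obtain ⟨d', hd', hne⟩ : ∃ d' < ℓ i, d ≠ d' := by
    have := hℓ i
    rcases d with _ | d
    exacts [⟨1, by omega, by omega⟩, ⟨0, by omega, by omega⟩]
  obtain ⟨X, hX, -, -, -, ⟨heX, -⟩, -⟩ := hC.sep (i, d) (i, d') he hd' (by simpa using hne)
  exact ⟨X, hX, heX⟩

lemma HasSystem.of_equiv (σ : ι ≃ ι') {ℓ : ι' → ℕ} {M : ℕ} (h : HasSystem (ℓ ∘ σ) κ M) :
    HasSystem ℓ κ M := by
  obtain ⟨C, hC, rfl⟩ := h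
  refine ⟨C.map (Prod.map (LegPath.map σ) id), ⟨fun X hX => ?_, ?_⟩, Multiset.card_map _ _⟩
  · obtain ⟨X, hX, rfl⟩ := Multiset.mem_map.1 hX
    exact hC.valid X ‹_›
  · rintro ⟨i, d⟩ ⟨j, d'⟩ he hf hne
    obtain ⟨i, rfl⟩ := σ.surjective i
    obtain ⟨j, rfl⟩ := σ.surjective j
    exact (hC.sep (i, d) (j, d') he hf (by simpa using hne)).map_leg σ.injective

lemma IsSeparating.sum {ℓ : ι → ℕ} {ℓ' : ι' → ℕ} {C : Multiset (LegPath ι × κ)}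
    {C' : Multiset (LegPath ι' × κ)} (hC : IsSeparating ℓ C) (hC' : IsSeparating ℓ' C')
    (hℓ : ∀ i, 2 ≤ ℓ i) (hbi : Bicoloured ℓ' C') :
    IsSeparating (Sum.elim ℓ ℓ') (C.map (Prod.map (LegPath.map Sum.inl) id) +
      C'.map (Prod.map (LegPath.map Sum.inr) id)) := by
  set D := C.map (Prod.map (LegPath.map (Sum.inl : ι → ι ⊕ ι')) id)
  set D' := C'.map (Prod.map (LegPath.map (Sum.inr : ι' → ι ⊕ ι')) id)
  have hmixed : ∀ (i : ι) (j : ι') (d d' : ℕ), d < ℓ i → d' < ℓ' j →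
      Separates LegPath.edges (D + D') (Sum.inl i, d) (Sum.inr j, d') := by
    intro i j d d' hd hd'
    obtain ⟨X, hX, heX⟩ := hC.exists_mem_edges hℓ (e := (i, d)) hd
    obtain ⟨Y, hY, hYX, hfY⟩ : ∃ Y ∈ C', X.2 ≠ Y.2 ∧ (j, d') ∈ Y.1.edges := by
      obtain ⟨Y, hY, Z, hZ, hYZ, hfY, hfZ⟩ := hbi (j, d') hd'
      by_cases hXY : X.2 = Y.2
      exacts [⟨Z, hZ, hXY ▸ hYZ, hfZ⟩, ⟨Y, hY, hXY, hfY⟩]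
    exact ⟨_, Multiset.mem_add.2 (.inl (Multiset.mem_map_of_mem _ hX)), _,
      Multiset.mem_add.2 (.inr (Multiset.mem_map_of_mem _ hY)), hYX,
      ⟨(LegPath.mem_edges_map_iff Sum.inl_injective X.1 (i, d)).2 heX,
        LegPath.notMem_edges_map _ (by simp)⟩,
      (LegPath.mem_edges_map_iff Sum.inr_injective Y.1 (j, d')).2 hfY,
        LegPath.notMem_edges_map _ (by simp)⟩
  refine ⟨fun X hX => ?_, ?_⟩
  · rcases Multiset.mem_add.1 hX with hX | hX <;> obtain ⟨X, hX', rfl⟩ := Multiset.mem_map.1 hX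
    exacts [hC.valid X hX', hC'.valid X hX']
  · rintro ⟨i | i, d⟩ ⟨j | j, d'⟩ he hf hne
    · exact ((hC.sep (i, d) (j, d') he hf (by simpa using hne)).map_leg Sum.inl_injective).mono
        (Multiset.subset_of_le (Multiset.le_add_right _ _))
    · exact hmixed i j d d' he hf
    · exact (hmixed j i d' d hf he).symm
    · exact ((hC'.sep (i, d) (j, d') he hf (by simpa using hne)).map_leg Sum.inr_injective).mono
        (Multiset.subset_of_le (Multiset.le_add_left _ _))

end Relabel

section UpperBound

lemma IsSeparating.hasSystem {ι κ : Type*} [Fintype ι] [Nontrivial κ]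
    {C : Multiset (LegPath ι × κ)} (hC : IsSeparating (fun _ => 2) C) {r : ℕ}
    (hcard : Multiset.card C = 2 * Fintype.card ι + r) {ℓ : ι → ℕ} (hℓ : ∀ i, 2 ≤ ℓ i)
    (hext : ∀ i, ℓ i ≠ 2 → Extendable (fun _ => 2) C i) : HasSystem ℓ κ (∑ i, ℓ i + r) := by
  obtain ⟨C', hC', hcard', -⟩ := hC.exists_lengthen hℓ fun i hi => hext i hi.symm
  refine ⟨C', hC', ?_⟩
  simp only [Finset.sum_const, Finset.card_univ, smul_eq_mul] at hcard'
  omega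

lemma HasSystem.add_triple {q r : ℕ} {ℓ : Fin (q + 3) → ℕ} (hℓ : ∀ i, 2 ≤ ℓ i)
    (h : HasSystem (ℓ ∘ Fin.castAdd 3) (Fin 2) (∑ i, ℓ (Fin.castAdd 3 i) + r)) :
    HasSystem ℓ (Fin 2) (∑ i, ℓ i + (r + 2)) := by
  obtain ⟨C, hC, hcardC⟩ := h
  obtain ⟨T, hT, hcard, hbi⟩ := isSeparating_threeLegs.exists_lengthen (ℓ' := ℓ ∘ Fin.natAdd q)
    (fun j => hℓ _) fun j _ => extendable_threeLegs j
  have hsplit : ℓ ∘ finSumFinEquiv = Sum.elim (ℓ ∘ Fin.castAdd 3) (ℓ ∘ Fin.natAdd q) := by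
    ext (i | j) <;> simp
  have hsum := hC.sum hT (fun i => hℓ _) (hbi bicoloured_threeLegs)
  rw [← hsplit] at hsum
  refine .of_equiv finSumFinEquiv ⟨_, hsum, ?_⟩
  have hcard₃ : Multiset.card threeLegs = 8 := rfl
  simp only [Finset.sum_const, Finset.card_univ, Fintype.card_fin, hcard₃,
    Function.comp_apply, smul_eq_mul] at hcard
  rw [Multiset.card_add, Multiset.card_map, Multiset.card_map, Fin.sum_univ_add]
  omega

lemma HasSystem.add_triples {q t r : ℕ} {ℓ : Fin (q + 3 * t) → ℕ} (hℓ : ∀ i, 2 ≤ ℓ i)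
    (h : HasSystem (ℓ ∘ Fin.castAdd (3 * t)) (Fin 2) (∑ i, ℓ (Fin.castAdd (3 * t) i) + r)) :
    HasSystem ℓ (Fin 2) (∑ i, ℓ i + (r + 2 * t)) := by
  induction t with
  | zero => exact h
  | succ t ih => exact HasSystem.add_triple (q := q + 3 * t) hℓ (ih (fun i => hℓ _) h)

lemma hasSystem {q : ℕ} (hq : 3 ≤ q) {ℓ : Fin q → ℕ} (hℓ : ∀ i, 2 ≤ ℓ i) :
    HasSystem ℓ (Fin 2) (∑ i, ℓ i + 2 * q / 3) := by
  obtain ⟨t, rfl | rfl | rfl⟩ : ∃ t, q = 3 + 3 * t ∨ q = 4 + 3 * t ∨ q = 5 + 3 * t :=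
    ⟨q / 3 - 1, by omega⟩
  · convert HasSystem.add_triples hℓ (isSeparating_threeLegs.hasSystem (r := 2) rfl
      (fun i => hℓ _) fun i _ => extendable_threeLegs i) using 2
    omega
  · convert HasSystem.add_triples hℓ (isSeparating_fourLegs.hasSystem (r := 2) rfl
      (fun i => hℓ _) fun i _ => extendable_fourLegs i) using 2
    omega
  · convert HasSystem.add_triples hℓ (isSeparating_fiveLegs.hasSystem (r := 3) rfl
      (fun i => hℓ _) fun i _ => extendable_fiveLegs i) using 2
    omega

lemma IsSeparating.hasSystem_of_two_short {m t r : ℕ} {C : Multiset (LegPath (Fin (m + 2)) × Fin 2)}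
    (hC : IsSeparating (fun _ => 2) C) (hext : ∀ i, i ≠ 0 → i ≠ 1 → Extendable (fun _ => 2) C i)
    (hcard : Multiset.card C = 2 * Fintype.card (Fin (m + 2)) + r) {ℓ : Fin (m + 2 + 3 * t) → ℕ}
    (hℓ : ∀ i, 2 ≤ ℓ i) {i j : Fin (m + 2 + 3 * t)} (hij : i ≠ j) (hi : ℓ i = 2) (hj : ℓ j = 2) :
    HasSystem ℓ (Fin 2) (∑ i, ℓ i + (r + 2 * t)) := by
  obtain ⟨σ, hσ₀, hσ₁⟩ : ∃ σ : Equiv.Perm (Fin (m + 2 + 3 * t)),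
      σ (Fin.castAdd _ 0) = i ∧ σ (Fin.castAdd _ 1) = j :=
    MulAction.is_two_pretransitive_iff.1 (Equiv.Perm.isMultiplyPretransitive _ 2)
      (by simp [Fin.ext_iff]) hij
  rw [← Equiv.sum_comp σ]
  refine .of_equiv σ (HasSystem.add_triples (fun _ => hℓ _)
    (hC.hasSystem hcard (fun _ => hℓ _) fun k hk => hext k ?_ ?_))
  · rintro rfl
    exact hk (by simp [hσ₀, hi])
  · rintro rfl
    exact hk (by simp [hσ₁, hj])

lemma hasSystem_of_two_short {q : ℕ} (hq : 3 < q) (hq' : q % 3 ≠ 1) {ℓ : Fin q → ℕ}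
    (hℓ : ∀ i, 2 ≤ ℓ i) {i j : Fin q} (hij : i ≠ j) (hi : ℓ i = 2) (hj : ℓ j = 2) :
    HasSystem ℓ (Fin 2) (∑ i, ℓ i + (2 * q / 3 - 1)) := by
  obtain ⟨t, rfl | rfl⟩ : ∃ t, q = 5 + 3 * t ∨ q = 6 + 3 * t :=
    ⟨(q - 5) / 3, by omega⟩
  · convert isSeparating_fiveLegsShort.hasSystem_of_two_short (r := 2) extendable_fiveLegsShort rfl
      hℓ hij hi hj using 2
    omega
  · convert isSeparating_sixLegsShort.hasSystem_of_two_short (r := 3) extendable_sixLegsShort rfl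
      hℓ hij hi hj using 2
    omega

end UpperBound

section Ends

variable {ι : Type*} [DecidableEq ι]

/-- The number of ends of `P` which the edge `e` separates from the centre. -/
def endsBeyond (e : ι × ℕ) (P : LegPath ι) : ℕ :=
  (if Beyond e P.1 then 1 else 0) + (if Beyond e P.2 then 1 else 0)

lemma mem_edges_iff_odd_endsBeyond {e : ι × ℕ} {P : LegPath ι} :
    e ∈ P.edges ↔ Odd (endsBeyond e P) := by
  by_cases h₁ : Beyond e P.1 <;> by_cases h₂ : Beyond e P.2 <;>
    simp [LegPath.edges, endsBeyond, h₁, h₂]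

lemma endsBeyond_succ_add_le (i : ι) (d : ℕ) (P : LegPath ι) :
    endsBeyond (i, d + 1) P + (if (i, d) ∈ P.edges ∧ (i, d + 1) ∉ P.edges then 1 else 0) +
      (if (i, d + 1) ∈ P.edges ∧ (i, d) ∉ P.edges then 1 else 0) ≤ endsBeyond (i, d) P := by
  have hmono : ∀ v, Beyond (i, d + 1) v → Beyond (i, d) v :=
    fun v h => ⟨h.1, Nat.lt_of_succ_lt h.2⟩
  have h₁ := hmono P.1
  have h₂ := hmono P.2
  simp only [LegPath.edges, Set.mem_ofPred_eq, endsBeyond]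
  by_cases hd₁ : Beyond (i, d) P.1 <;> by_cases hd₂ : Beyond (i, d) P.2 <;>
    by_cases hs₁ : Beyond (i, d + 1) P.1 <;> by_cases hs₂ : Beyond (i, d + 1) P.2 <;>
    simp_all

variable [Fintype ι]

/-- The legs on which `P` uses the edge at the centre. -/
def innerLegs (P : LegPath ι) : Finset ι := {i | (i, 0) ∈ P.edges}

lemma sum_endsBeyond_le_two (P : LegPath ι) : ∑ i, endsBeyond (i, 0) P ≤ 2 := by
  have hend : ∀ v : ι × ℕ, (∑ i, if Beyond (i, 0) v then 1 else 0) ≤ 1 := by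
    intro v
    rw [← Finset.card_filter, Finset.card_le_one]
    intro i hi j hj
    exact (Finset.mem_filter.1 hi).2.1.trans (Finset.mem_filter.1 hj).2.1.symm
  simp only [endsBeyond, Finset.sum_add_distrib]
  exact add_le_add (hend P.1) (hend P.2)

lemma odd_sum_endsBeyond_iff (P : LegPath ι) :
    Odd (∑ i, endsBeyond (i, 0) P) ↔ Odd (innerLegs P).card := by
  simp only [Finset.odd_sum_iff_odd_card_odd, innerLegs, mem_edges_iff_odd_endsBeyond]

end Ends

section ColourClass

variable {ι κ α : Type*} [DecidableEq ι] [Fintype α]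

/-- The members of the family `X` of coloured paths through the edge `e`. -/
def pathsThrough (X : α → LegPath ι × κ) (e : ι × ℕ) : Finset α := {x | e ∈ (X x).1.edges}

/-- The members of the family `X` of colour `γ` through the edge `e`. -/
def colourClass [DecidableEq κ] (X : α → LegPath ι × κ) (γ : κ) (e : ι × ℕ) : Finset α :=
  {x ∈ pathsThrough X e | (X x).2 = γ}

/-- The number of ends of the paths of `X` which `e` separates from the centre. -/
def totalEnds (X : α → LegPath ι × κ) (e : ι × ℕ) : ℕ := ∑ x, endsBeyond e (X x).1

variable {X : α → LegPath ι × κ} {ℓ : ι → ℕ}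

lemma mem_pathsThrough {e : ι × ℕ} {x : α} : x ∈ pathsThrough X e ↔ e ∈ (X x).1.edges := by
  simp [pathsThrough]

lemma mem_colourClass [DecidableEq κ] {γ : κ} {e : ι × ℕ} {x : α} :
    x ∈ colourClass X γ e ↔ e ∈ (X x).1.edges ∧ (X x).2 = γ := by
  simp [colourClass, pathsThrough]

lemma card_pathsThrough_le_totalEnds (e : ι × ℕ) : (pathsThrough X e).card ≤ totalEnds X e := by
  rw [pathsThrough, Finset.card_filter]
  refine Finset.sum_le_sum fun x _ => ?_
  split_ifs with hx
  exacts [(mem_edges_iff_odd_endsBeyond.1 hx).pos, Nat.zero_le _]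

lemma sum_card_pathsThrough [Fintype ι] (X : α → LegPath ι × κ) :
    ∑ i, (pathsThrough X (i, 0)).card = ∑ x, (innerLegs (X x).1).card :=
  Finset.sum_card_bipartiteAbove_eq_sum_card_bipartiteBelow fun i x => (i, 0) ∈ (X x).1.edges

lemma totalEnds_succ_add_le [DecidableEq α] (i : ι) (d : ℕ) :
    totalEnds X (i, d + 1) + (pathsThrough X (i, d) \ pathsThrough X (i, d + 1)).card +
      (pathsThrough X (i, d + 1) \ pathsThrough X (i, d)).card ≤ totalEnds X (i, d) := by
  simp only [pathsThrough, ← Finset.filter_and_not, Finset.card_filter, totalEnds,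
    ← Finset.sum_add_distrib]
  exact Finset.sum_le_sum fun x _ => endsBeyond_succ_add_le i d (X x).1

lemma IsSeparating.pathsThrough_sdiff_nonempty [DecidableEq α]
    (hX : IsSeparating ℓ (Finset.univ.val.map X)) {e f : ι × ℕ} (he : e.2 < ℓ e.1)
    (hf : f.2 < ℓ f.1) (hne : e ≠ f) : (pathsThrough X e \ pathsThrough X f).Nonempty := by
  obtain ⟨Y, hY, -, -, -, ⟨heY, hfY⟩, -⟩ := hX.sep e f he hf hne
  obtain ⟨x, -, rfl⟩ := Multiset.mem_map.1 hY
  exact ⟨x, by simp [mem_pathsThrough, heY, hfY]⟩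

lemma IsSeparating.card_pathsThrough_add_le_totalEnds
    (hX : IsSeparating ℓ (Finset.univ.val.map X)) {i : ι} {d m : ℕ} (hd : d + m + 1 = ℓ i) :
    (pathsThrough X (i, d)).card + 2 * m ≤ totalEnds X (i, d) := by
  classical
  induction m generalizing d with
  | zero => exact card_pathsThrough_le_totalEnds _
  | succ m ih =>
    have hnext := ih (d := d + 1) (by omega)
    have hstep := totalEnds_succ_add_le (X := X) i d
    have hnew := (hX.pathsThrough_sdiff_nonempty (e := (i, d + 1)) (f := (i, d))
      (by simp only; omega) (by simp only; omega) (by simp)).card_pos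
    have hcard := Finset.card_sdiff_add_card (pathsThrough X (i, d)) (pathsThrough X (i, d + 1))
    have hcard' := Finset.card_sdiff_add_card (pathsThrough X (i, d + 1)) (pathsThrough X (i, d))
    rw [Finset.union_comm] at hcard'
    omega

variable [DecidableEq κ]

lemma filter_pathsThrough_sdiff [DecidableEq α] (γ : κ) (e f : ι × ℕ) :
    {x ∈ pathsThrough X e \ pathsThrough X f | (X x).2 = γ} =
      colourClass X γ e \ colourClass X γ f := by
  ext x
  simp only [Finset.mem_filter, Finset.mem_sdiff, mem_pathsThrough, mem_colourClass]
  tauto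

lemma IsSeparating.exists_colourClass_sdiff_nonempty [DecidableEq α]
    (hX : IsSeparating ℓ (Finset.univ.val.map X)) {e f : ι × ℕ} (he : e.2 < ℓ e.1)
    (hf : f.2 < ℓ f.1) (hne : e ≠ f) :
    ∃ γ δ, γ ≠ δ ∧ (colourClass X γ e \ colourClass X γ f).Nonempty ∧
      (colourClass X δ f \ colourClass X δ e).Nonempty := by
  obtain ⟨Y, hY, Z, hZ, hYZ, ⟨heY, hfY⟩, hfZ, heZ⟩ := hX.sep e f he hf hne
  obtain ⟨x, -, rfl⟩ := Multiset.mem_map.1 hY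
  obtain ⟨y, -, rfl⟩ := Multiset.mem_map.1 hZ
  exact ⟨_, _, hYZ, ⟨x, by simp [mem_colourClass, heY, hfY]⟩,
    ⟨y, by simp [mem_colourClass, hfZ, heZ]⟩⟩

lemma IsSeparating.colourClass_ne {X : α → LegPath ι × Fin 2}
    (hX : IsSeparating ℓ (Finset.univ.val.map X)) {e f : ι × ℕ} (he : e.2 < ℓ e.1)
    (hf : f.2 < ℓ f.1) (hne : e ≠ f) (γ : Fin 2) : colourClass X γ e ≠ colourClass X γ f := by
  classical
  intro heq
  obtain ⟨γ', δ, hγδ, hγ', hδ⟩ := hX.exists_colourClass_sdiff_nonempty he hf hne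
  obtain rfl | rfl : γ = γ' ∨ γ = δ := by omega
  · simp [heq] at hγ'
  · simp [heq] at hδ

end ColourClass

section Charge

variable {α : Type*}

lemma eq_empty_or_singleton_or_two_le_card (F : Finset α) :
    F = ∅ ∨ (∃ x, F = {x}) ∨ 2 ≤ F.card := by
  rw [← Finset.card_eq_zero, ← Finset.card_eq_one]
  omega

variable [DecidableEq α] {F S : Finset α}

lemma mem_iff_mem_of_subset_pair {x y : α} (hF : F ⊆ {x, y}) (hcard : F.card ≠ 1) :
    x ∈ F ↔ y ∈ F := by
  have himp : ∀ x y, F ⊆ {x, y} → x ∈ F → y ∈ F := by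
    intro x y hF hx
    by_contra hy
    refine hcard (Finset.card_eq_one.2 ⟨x, Finset.eq_singleton_iff_unique_mem.2 ⟨hx, ?_⟩⟩)
    intro z hz
    obtain rfl | rfl : z = x ∨ z = y := by simpa using hF hz
    exacts [rfl, absurd hz hy]
  exact ⟨himp x y hF, himp y x (Finset.pair_comm x y ▸ hF)⟩

/-- The elements `x` of `F` such that `F = {x}` or `S = {x}`. It is applied to the colour classes
`F` and `S` of the first and the second edge of a leg; as distinct edges have distinct colour
classes, no path is pinned on two legs. -/
def pinned (F S : Finset α) : Finset α := {x ∈ F | F = {x} ∨ S = {x}}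

/-- The penalty for empty colour classes `F` and `S` of the first and the second edge of a leg. -/
def deficit (F S : Finset α) : ℕ := (if F = ∅ then 2 else 0) + (if S = ∅ then 1 else 0)

/-- The contribution to the leg inequality of a colour for which the first and the second edge of
the leg have the classes `F` and `S`. -/
def charge (F S : Finset α) : ℕ := (pinned F S).card + F.card + 3 * (S \ F).card + deficit F S

lemma card_pinned_singleton (x : α) (S : Finset α) : (pinned {x} S).card = 1 := by
  rw [pinned, Finset.filter_true_of_mem (by simp), Finset.card_singleton]

lemma card_pinned_pos {x : α} (hx : x ∈ F) : 0 < (pinned F {x}).card :=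
  Finset.card_pos.2 ⟨x, Finset.mem_filter.2 ⟨hx, .inr rfl⟩⟩

lemma three_le_charge (h : (F \ S).Nonempty) : 3 ≤ charge F S := by
  have hF := (h.mono Finset.sdiff_subset).card_pos
  unfold charge
  by_cases hSF : (S \ F).Nonempty
  · have := hSF.card_pos
    omega
  rw [Finset.not_nonempty_iff_eq_empty, Finset.sdiff_eq_empty_iff_subset] at hSF
  have hlt : S.card < F.card := Finset.card_lt_card (hSF.ssubset_of_ne (by
    rintro rfl
    simp at h))
  rcases eq_empty_or_singleton_or_two_le_card S with rfl | ⟨x, rfl⟩ | hS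
  · have hdeficit : 1 ≤ deficit F ∅ := by simp [deficit]
    rcases eq_empty_or_singleton_or_two_le_card F with rfl | ⟨x, rfl⟩ | hF₂
    · simp at h
    · rw [card_pinned_singleton]
      omega
    · omega
  · have := card_pinned_pos (hSF (Finset.mem_singleton_self x))
    rw [Finset.card_singleton] at hlt
    omega
  · omega

lemma five_le_charge (h : (S \ F).Nonempty) : 5 ≤ charge F S := by
  have hSF := h.card_pos
  unfold charge
  rcases eq_empty_or_singleton_or_two_le_card F with rfl | ⟨x, rfl⟩ | hF
  · have hdeficit : 2 ≤ deficit ∅ S := by simp [deficit]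
    omega
  · rw [card_pinned_singleton, Finset.card_singleton]
    omega
  · omega

end Charge

section EndingAtCentre

variable {ι α : Type*} [Fintype ι] [DecidableEq ι] [Fintype α] {ℓ : ι → ℕ}
  {X : α → LegPath ι × Fin 2}

/-- The members of the family `X` with one end at the centre and the other end elsewhere. -/
def endingAtCentre {κ : Type*} (X : α → LegPath ι × κ) : Finset α :=
  {x | (innerLegs (X x).1).card = 1}

lemma IsSeparating.endingAtCentre_nonempty (hX : IsSeparating ℓ (Finset.univ.val.map X))
    (hℓ : ∀ i, 2 ≤ ℓ i) (hι : Fintype.card ι = 3) {γ : Fin 2} {k : ι}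
    (hk : colourClass X γ (k, 0) = ∅) :
    {x ∈ endingAtCentre X | (X x).2 = γ}.Nonempty := by
  have hcard : (Finset.univ.erase k).card = 2 := by simp [hι]
  obtain ⟨i, j, hij, hlegs⟩ := Finset.card_eq_two.1 hcard
  have hne : colourClass X γ (i, 0) ≠ colourClass X γ (j, 0) :=
    hX.colourClass_ne (zero_lt_two.trans_le (hℓ i)) (zero_lt_two.trans_le (hℓ j))
      (fun h => hij (congrArg Prod.fst h)) γ
  by_contra hnone
  rw [Finset.not_nonempty_iff_eq_empty, Finset.filter_eq_empty_iff] at hnone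
  refine hne (Finset.ext fun x => ?_)
  simp only [mem_colourClass, and_congr_left_iff]
  intro hγ
  have hsub : innerLegs (X x).1 ⊆ {i, j} := by
    intro l hl
    rw [← hlegs, Finset.mem_erase]
    refine ⟨?_, Finset.mem_univ l⟩
    rintro rfl
    have hmem : x ∈ colourClass X γ (l, 0) := mem_colourClass.2 ⟨by simpa [innerLegs] using hl, hγ⟩
    simp [hk] at hmem
  have hcentre : (innerLegs (X x).1).card ≠ 1 := fun h =>
    hnone (by simpa [endingAtCentre] using h) hγ
  simpa [innerLegs] using mem_iff_mem_of_subset_pair hsub hcentre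

end EndingAtCentre

section LowerBound

variable {ι κ α : Type*} [DecidableEq ι] [DecidableEq κ] [Fintype α] [DecidableEq α]
  {ℓ : ι → ℕ}

/-- The paths pinned on leg `i` by the colour classes of the first two edges of the leg. -/
def pinnedPaths (X : α → LegPath ι × κ) (i : ι) : Finset α :=
  {x | x ∈ pinned (colourClass X (X x).2 (i, 0)) (colourClass X (X x).2 (i, 1))}

/-- The penalty of leg `i` for the colour `γ`. -/
def legDeficit (X : α → LegPath ι × κ) (γ : κ) (i : ι) : ℕ :=
  deficit (colourClass X γ (i, 0)) (colourClass X γ (i, 1))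

lemma card_pinnedPaths [Fintype κ] (X : α → LegPath ι × κ) (i : ι) :
    (pinnedPaths X i).card =
      ∑ γ, (pinned (colourClass X γ (i, 0)) (colourClass X γ (i, 1))).card := by
  rw [Finset.card_eq_sum_card_fiberwise (f := fun x => (X x).2) (t := Finset.univ)
    fun _ _ => Finset.mem_coe.2 (Finset.mem_univ _)]
  refine Finset.sum_congr rfl fun γ _ => congrArg Finset.card (Finset.ext fun x => ?_)
  simp only [pinnedPaths, Finset.mem_filter, Finset.mem_univ, true_and]
  refine ⟨fun ⟨hx, hγ⟩ => hγ ▸ hx, fun hx => ?_⟩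
  have hγ : (X x).2 = γ := (mem_colourClass.1 (Finset.mem_filter.1 hx).1).2
  exact ⟨hγ.symm ▸ hx, hγ⟩

lemma IsSeparating.eight_le_sum_charge [Fintype κ] {X : α → LegPath ι × κ}
    (hX : IsSeparating ℓ (Finset.univ.val.map X)) {i : ι} (hℓ : 2 ≤ ℓ i) :
    8 ≤ ∑ γ, charge (colourClass X γ (i, 0)) (colourClass X γ (i, 1)) := by
  obtain ⟨γ, δ, hγδ, hγ, hδ⟩ := hX.exists_colourClass_sdiff_nonempty (e := (i, 0)) (f := (i, 1))
    (by simp only; omega) (by simp only; omega) (by simp)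
  have hsum := Finset.add_le_sum
    (f := fun γ => charge (colourClass X γ (i, 0)) (colourClass X γ (i, 1)))
    (fun _ _ => Nat.zero_le _) (Finset.mem_univ γ) (Finset.mem_univ δ) hγδ
  exact (add_le_add (three_le_charge hγ) (five_le_charge hδ)).trans hsum

lemma IsSeparating.leg_inequality [Fintype κ] {X : α → LegPath ι × κ}
    (hX : IsSeparating ℓ (Finset.univ.val.map X)) {i : ι} (hℓ : 2 ≤ ℓ i) :
    4 + 6 * ℓ i + (pathsThrough X (i, 0)).card ≤
      2 * (pinnedPaths X i).card + 3 * totalEnds X (i, 0) + 2 * ∑ γ, legDeficit X γ i := by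
  have hcharge := hX.eight_le_sum_charge hℓ
  have htail := hX.card_pathsThrough_add_le_totalEnds (i := i) (d := 1) (m := ℓ i - 2) (by omega)
  have hstep := totalEnds_succ_add_le (X := X) i 0
  have hcard := Finset.card_sdiff_add_card (pathsThrough X (i, 0)) (pathsThrough X (i, 1))
  have hcard' := Finset.card_sdiff_add_card (pathsThrough X (i, 1)) (pathsThrough X (i, 0))
  rw [Finset.union_comm] at hcard'
  have hF : (pathsThrough X (i, 0)).card = ∑ γ, (colourClass X γ (i, 0)).card :=
    Finset.card_eq_sum_card_fiberwise fun _ _ => Finset.mem_coe.2 (Finset.mem_univ _)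
  have hSF : (pathsThrough X (i, 1) \ pathsThrough X (i, 0)).card =
      ∑ γ, (colourClass X γ (i, 1) \ colourClass X γ (i, 0)).card := by
    simp only [← filter_pathsThrough_sdiff]
    exact Finset.card_eq_sum_card_fiberwise fun _ _ => Finset.mem_coe.2 (Finset.mem_univ _)
  simp only [charge, Finset.sum_add_distrib, ← Finset.mul_sum, ← card_pinnedPaths, ← hF, ← hSF]
    at hcharge
  simp only [zero_add] at hstep
  simp only [legDeficit]
  omega

variable [Fintype ι]

/-- The legs on which the path `x` is pinned. -/
def pinnedLegs (X : α → LegPath ι × κ) (x : α) : Finset ι := {i | x ∈ pinnedPaths X i}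

lemma sum_card_pinnedPaths (X : α → LegPath ι × κ) :
    ∑ i, (pinnedPaths X i).card = ∑ x, (pinnedLegs X x).card := by
  have h := Finset.sum_card_bipartiteAbove_eq_sum_card_bipartiteBelow (s := Finset.univ)
    (t := Finset.univ) fun (i : ι) x => x ∈ pinnedPaths X i
  simpa [Finset.bipartiteAbove, Finset.bipartiteBelow, pinnedLegs] using h

lemma pinnedLegs_subset_innerLegs (X : α → LegPath ι × κ) (x : α) :
    pinnedLegs X x ⊆ innerLegs (X x).1 := by
  intro i hi
  simp only [pinnedLegs, pinnedPaths, pinned, Finset.mem_filter, Finset.mem_univ,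
    true_and, mem_colourClass] at hi
  simpa [innerLegs] using hi.1.1

variable {X : α → LegPath ι × Fin 2}

lemma IsSeparating.card_pinnedLegs_le_one (hX : IsSeparating ℓ (Finset.univ.val.map X))
    (hℓ : ∀ i, 2 ≤ ℓ i) (x : α) : (pinnedLegs X x).card ≤ 1 := by
  have hclass : ∀ i ∈ pinnedLegs X x, ∃ d < ℓ i, colourClass X (X x).2 (i, d) = {x} := by
    intro i hi
    simp only [pinnedLegs, pinnedPaths, pinned, Finset.mem_filter, Finset.mem_univ,
      true_and] at hi
    exact hi.2.elim (fun h => ⟨0, by linarith [hℓ i], h⟩) (fun h => ⟨1, by linarith [hℓ i], h⟩)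
  rw [Finset.card_le_one]
  intro i hi j hj
  obtain ⟨d, hd, hid⟩ := hclass i hi
  obtain ⟨d', hd', hjd'⟩ := hclass j hj
  by_contra hij
  exact hX.colourClass_ne (e := (i, d)) (f := (j, d')) hd hd' (fun h => hij (congrArg Prod.fst h))
    (X x).2 (hid.trans hjd'.symm)

lemma IsSeparating.path_inequality (hX : IsSeparating ℓ (Finset.univ.val.map X))
    (hℓ : ∀ i, 2 ≤ ℓ i) (x : α) :
    2 * (pinnedLegs X x).card + 3 * ∑ i, endsBeyond (i, 0) (X x).1 +
      2 * (if x ∈ endingAtCentre X then 1 else 0) ≤ 6 + (innerLegs (X x).1).card := by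
  have hpinned := hX.card_pinnedLegs_le_one hℓ x
  have hle := Finset.card_le_card (pinnedLegs_subset_innerLegs X x)
  have hends := sum_endsBeyond_le_two (X x).1
  have hodd := odd_sum_endsBeyond_iff (X x).1
  rw [Nat.odd_iff, Nat.odd_iff] at hodd
  simp only [endingAtCentre, Finset.mem_filter, Finset.mem_univ, true_and]
  split_ifs <;> omega

lemma IsSeparating.counting_inequality (hX : IsSeparating ℓ (Finset.univ.val.map X))
    (hℓ : ∀ i, 2 ≤ ℓ i) :
    4 * Fintype.card ι + 6 * ∑ i, ℓ i + 2 * (endingAtCentre X).card ≤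
      6 * Fintype.card α + 2 * ∑ γ, ∑ i, legDeficit X γ i := by
  have hlegs := Finset.sum_le_sum fun i (_ : i ∈ Finset.univ) => hX.leg_inequality (hℓ i)
  have hpaths := Finset.sum_le_sum fun x (_ : x ∈ Finset.univ) => hX.path_inequality hℓ x
  have hends : ∑ i, totalEnds X (i, 0) = ∑ x, ∑ i, endsBeyond (i, 0) (X x).1 := Finset.sum_comm
  simp only [Finset.sum_add_distrib, ← Finset.mul_sum, Finset.sum_const, Finset.card_univ,
    smul_eq_mul, sum_card_pathsThrough, sum_card_pinnedPaths, hends, ← Finset.card_filter,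
    Finset.filter_univ_mem] at hlegs hpaths
  rw [Finset.sum_comm (s := Finset.univ (α := Fin 2))]
  omega

lemma IsSeparating.sum_legDeficit_le_one (hX : IsSeparating ℓ (Finset.univ.val.map X))
    (hℓ : ∀ i, 2 ≤ ℓ i) {γ : Fin 2} (h : ∀ i, colourClass X γ (i, 0) ≠ ∅) :
    ∑ i, legDeficit X γ i ≤ 1 := by
  have hdeficit : ∀ i, legDeficit X γ i = if colourClass X γ (i, 1) = ∅ then 1 else 0 := by
    intro i
    rw [legDeficit, deficit, if_neg (h i), zero_add]
  simp only [hdeficit, ← Finset.card_filter]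
  rw [Finset.card_le_one]
  intro i hi j hj
  by_contra hij
  exact hX.colourClass_ne (e := (i, 1)) (f := (j, 1)) (hℓ i) (hℓ j)
    (fun h => hij (congrArg Prod.fst h)) γ
    ((Finset.mem_filter.1 hi).2.trans (Finset.mem_filter.1 hj).2.symm)

lemma IsSeparating.sum_legDeficit_le_two (hX : IsSeparating ℓ (Finset.univ.val.map X))
    (hℓ : ∀ i, 2 ≤ ℓ i) (γ : Fin 2) : ∑ i, legDeficit X γ i ≤ 2 := by
  by_cases h : ∀ i, colourClass X γ (i, 0) ≠ ∅
  · exact (hX.sum_legDeficit_le_one hℓ h).trans one_le_two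
  push Not at h
  obtain ⟨i, hi⟩ := h
  have hne : ∀ e : ι × ℕ, e.2 < ℓ e.1 → e ≠ (i, 0) → colourClass X γ e ≠ ∅ := fun e he hei =>
    hi ▸ hX.colourClass_ne he (zero_lt_two.trans_le (hℓ i)) hei γ
  rw [Finset.sum_eq_single i (fun j _ hji => ?_) (by simp)]
  · rw [legDeficit, deficit, if_pos hi, if_neg (hne (i, 1) (hℓ i) (by simp))]
  · rw [legDeficit, deficit, if_neg (hne (j, 0) (zero_lt_two.trans_le (hℓ j)) (by simp [hji])),
      if_neg (hne (j, 1) (hℓ j) (by simp [hji])), add_zero]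

end LowerBound

section Bounds

variable {ι κ : Type*} {ℓ : ι → ℕ} {M : ℕ}

lemma HasSystem.exists_family (h : HasSystem ℓ κ M) :
    ∃ X : Fin M → LegPath ι × κ, IsSeparating ℓ (Finset.univ.val.map X) := by
  obtain ⟨C, hC, rfl⟩ := h
  obtain ⟨L, rfl⟩ : ∃ L : List (LegPath ι × κ), L = C := ⟨C.toList, C.coe_toList⟩
  have hL : Finset.univ.val.map L.get = (L : Multiset (LegPath ι × κ)) := by
    rw [Fin.univ_val_map, List.ofFn_get]
  exact ⟨L.get, hL.symm ▸ hC⟩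

variable [Fintype ι]

lemma HasSystem.lower_bound (h : HasSystem ℓ (Fin 2) M) (hℓ : ∀ i, 2 ≤ ℓ i) :
    2 * Fintype.card ι + 3 * ∑ i, ℓ i ≤ 3 * M + 4 := by
  classical
  obtain ⟨X, hX⟩ := h.exists_family
  have hcount := hX.counting_inequality hℓ
  have h₀ := hX.sum_legDeficit_le_two hℓ 0
  have h₁ := hX.sum_legDeficit_le_two hℓ 1
  rw [Fin.sum_univ_two, Fintype.card_fin] at hcount
  omega

lemma HasSystem.lower_bound_three (h : HasSystem ℓ (Fin 2) M) (hℓ : ∀ i, 2 ≤ ℓ i)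
    (hι : Fintype.card ι = 3) : ∑ i, ℓ i + 2 ≤ M := by
  classical
  obtain ⟨X, hX⟩ := h.exists_family
  have hdeficit : ∀ γ : Fin 2,
      ∑ i, legDeficit X γ i ≤ 1 + {x ∈ endingAtCentre X | (X x).2 = γ}.card := by
    intro γ
    by_cases h : ∀ i, colourClass X γ (i, 0) ≠ ∅
    · exact (hX.sum_legDeficit_le_one hℓ h).trans (Nat.le_add_right _ _)
    · push Not at h
      obtain ⟨k, hk⟩ := h
      have hpos := Finset.card_pos.2 (hX.endingAtCentre_nonempty hℓ hι hk)
      have htwo := hX.sum_legDeficit_le_two hℓ γ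
      omega
  have hcentre : (endingAtCentre X).card = ∑ γ, {x ∈ endingAtCentre X | (X x).2 = γ}.card :=
    Finset.card_eq_sum_card_fiberwise fun _ _ => Finset.mem_coe.2 (Finset.mem_univ _)
  have hcount := hX.counting_inequality hℓ
  have h₀ := hdeficit 0
  have h₁ := hdeficit 1
  rw [Fin.sum_univ_two] at hcount hcentre
  rw [Fintype.card_fin] at hcount
  omega

lemma card_eq_sum_add_one_of_iso_spider {V : Type*} [Fintype V] {G : SimpleGraph V}
    {q : ℕ} {ℓ : Fin q → ℕ} (φ : G ≃g spider ℓ) : Fintype.card V = ∑ i, ℓ i + 1 := by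
  simp [Fintype.card_congr φ.toEquiv]

end Bounds

end RainbowSep

theorem mainTheorem9 {V : Type*} [Fintype V] (G : SimpleGraph V) (n q : ℕ) (ℓ : Fin q → ℕ)
    (hq : 3 ≤ q) (hℓ : ∀ i, 2 ≤ ℓ i)
    (hG : Nonempty (G ≃g RainbowSep.spider ℓ)) (hn : Fintype.card V = n) :
    ((q = 3 ∨ 2 ≤ (Finset.univ.filter fun i => ℓ i = 2).card) →
      ((q = 3 ∨ q % 3 = 1) → RainbowSep.rainbowSepNumber G 2 = n - 1 + 2 * q / 3) ∧
      (¬ (q = 3 ∨ q % 3 = 1) → RainbowSep.rainbowSepNumber G 2 = n - 2 + 2 * q / 3)) ∧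
    ((3 < q ∧ (Finset.univ.filter fun i => ℓ i = 2).card ≤ 1) →
      (q % 3 = 1 → RainbowSep.rainbowSepNumber G 2 = n - 1 + 2 * q / 3) ∧
      (¬ q % 3 = 1 → ∃ ε : ℕ, (ε = 0 ∨ ε = 1) ∧
        RainbowSep.rainbowSepNumber G 2 = n - 2 + 2 * q / 3 + ε)) := by
  obtain ⟨φ⟩ := hG
  rw [RainbowSep.card_eq_sum_add_one_of_iso_spider φ] at hn
  have : Nonempty (Fin q) := ⟨⟨0, by omega⟩⟩
  rw [RainbowSep.rainbowSepNumber_congr φ, RainbowSep.rainbowSepNumber_spider]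
  set m := sInf {M | RainbowSep.HasSystem ℓ (Fin 2) M}
  have hsum : 0 < ∑ i, ℓ i :=
    Finset.sum_pos (fun i _ => zero_lt_two.trans_le (hℓ i)) Finset.univ_nonempty
  have hupper : m ≤ ∑ i, ℓ i + 2 * q / 3 := Nat.sInf_le (RainbowSep.hasSystem hq hℓ)
  have hm : RainbowSep.HasSystem ℓ (Fin 2) m :=
    Nat.sInf_mem (s := {M | RainbowSep.HasSystem ℓ (Fin 2) M}) ⟨_, RainbowSep.hasSystem hq hℓ⟩
  have hlower := hm.lower_bound hℓ
  have hlower_three := hm.lower_bound_three hℓ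
  rw [Fintype.card_fin] at hlower hlower_three
  have hupper_short : 3 < q → q % 3 ≠ 1 → 2 ≤ (Finset.univ.filter fun i => ℓ i = 2).card →
      m ≤ ∑ i, ℓ i + (2 * q / 3 - 1) := by
    intro hq₃ hq₁ hshort
    obtain ⟨i, hi, j, hj, hij⟩ := Finset.one_lt_card.1 hshort
    exact Nat.sInf_le (RainbowSep.hasSystem_of_two_short hq₃ hq₁ hℓ hij
      (Finset.mem_filter.1 hi).2 (Finset.mem_filter.1 hj).2)
  refine ⟨fun hshort => ⟨?_, ?_⟩, fun _ => ⟨?_, fun _ => ⟨m - (n - 2 + 2 * q / 3), ?_⟩⟩⟩ <;> omega
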